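/- **Setting.** Let $N\ge 1$ and let $C\subset\mathbb R_+^N$ be a compact convex set containing the simplex $\Sigma=\{x\in\mathbb R^N: x_i\ge 0,\ x_1+\cdots+x_N\le 1\}$. Let $K\subset\mathbb C^N$ be compact and let $w\colon K\to[0,\infty)$ be a bounded function (for example a continuous, or an upper semicontinuous, weight). For $k\in\mathbb N$ let $\mathrm{Poly}(kC)$ be the space of polynomials $\sum_{\alpha\in kC\cap\mathbb Z^N}c_\alpha z^\alpha$, let $M_k=\#(kC\cap\mathbb Z^N)$, $L_k=\sum_{\alpha\in kC\cap\mathbb Z^N}|\alpha|$ (where $|\alpha|=\alpha_1+\cdots+\alpha_N$), and let $$A_N=\frac1{\mathrm{vol}_N(C)}\int_C(\theta_1+\cdots+\theta_N)\,d\theta .$$ Write $\alpha\prec\beta$ if $|\alpha|<|\beta|$, or if $|\alpha|=|\beta|$ and for some $m$ one has $\alpha_m<\beta_m$ and $\alpha_j=\beta_j$ for all $j<m$ (the ordering called grevlex here). For $\alpha\in kC\cap\mathbb Z^N$ put $$T_k(\alpha)=\Bigl(\inf\bigl\{\sup_{z\in K}w(z)^k|p(z)| : p=z^\alpha+\sum_{\beta\in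 kC\cap\mathbb Z^N,\ \beta\prec\alpha}a_\beta z^\beta\bigr\}\Bigr)^{1/k},$$ and for $\theta\in\mathrm{int}(C)$ let $$T^w_\prec(K,\theta)=\lim_{k\to\infty,\ \alpha/k\to\theta}T_k(\alpha),$$ the limit being over pairs $(k,\alpha)$ with $\alpha\in kC\cap\mathbb Z^N$. For an enumeration $\alpha(1),\dots,\alpha(M_k)$ of $kC\cap\mathbb Z^N$ let $$V_k^w(K,M_k)=\sup_{\zeta_1,\dots,\zeta_{M_k}\in K}\bigl|\det[\,w(\zeta_l)^k\zeta_l^{\alpha(j)}]_{j,l=1}^{M_k}\bigr|,\qquad \delta^w_C(K)=\limsup_{k\to\infty}V_k^w(K,M_k)^{1/L_k}.$$ (Suprema over the empty set are $0$; $\log 0=-\infty$ and $\exp(-\infty)=0$.) **Theorem.** The limit defining $T^w_\prec(K,\theta)$ exists in $[0,\infty)$ for every $\theta\in\mathrm{int}(C)$, and $\theta\mapsto\log T^w_\prec(K,\theta)\in[-\infty,\infty)$ is Lebesgue measurable on $\mathrm{int}(C)$ with integrable positive part. For any choice of the enumerations, the limit $$D^w(K)=\lim_{k\to\infty}V_k^w(K,M_k)^{1/(kM_k)}$$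 exists in $[0,\infty)$, and $$D^w(K)=\exp\Bigl(\frac1{\mathrm{vol}_N(C)}\int_{\mathrm{int}(C)}\log T^w_\prec(K,\theta)\,d\theta\Bigr).$$ Moreover the $\limsup$ defining $\delta^w_C(K)$ is a limit, and $\delta^w_C(K)=D^w(K)^{1/A_N}$. -/

import Mathlib

open Filter Topology MeasureTheory
open scoped Pointwise ENNReal

noncomputable section

namespace ChebTransform

variable {N : ℕ}

/-- The standard simplex `Σ = {x ∈ ℝ^N : x ≥ 0, x₁ + ⋯ + x_N ≤ 1}`. -/
def simplex (N : ℕ) : Set (Fin N → ℝ) :=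
  {x | (∀ i, 0 ≤ x i) ∧ ∑ i, x i ≤ 1}

/-- A multi-index, viewed as a vector of `ℝ^N`. -/
def expVec (α : Fin N →₀ ℕ) : Fin N → ℝ := fun i => (α i : ℝ)

/-- The exponents `kC ∩ ℤ^N`. For `C ⊆ ℝ₊^N` all of them lie in `ℕ^N`. -/
def latticePoints (C : Set (Fin N → ℝ)) (k : ℕ) : Set (Fin N →₀ ℕ) :=
  {α | expVec α ∈ (k : ℝ) • C}

/-- `Poly(kC)`: the polynomials whose exponents all lie in `kC`. -/
def polyC (C : Set (Fin N → ℝ)) (k : ℕ) : Submodule ℂ (MvPolynomial (Fin N) ℂ) :=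
  MvPolynomial.restrictSupport ℂ (latticePoints C k)

/-- The ordering `α ≺ β`: compare total degrees, and break ties lexicographically. -/
def Grevlex (α β : Fin N →₀ ℕ) : Prop :=
  α.degree < β.degree ∨
    (α.degree = β.degree ∧ ∃ m : Fin N, α m < β m ∧ ∀ j < m, α j = β j)

/-- The class of polynomials `z^α + ∑_{β ∈ kC, β ≺ α} a_β z^β` in `Poly(kC)`. -/
def monicClass (C : Set (Fin N → ℝ)) (k : ℕ) (α : Fin N →₀ ℕ) :
    Set (MvPolynomial (Fin N) ℂ) :=
  {p | p ∈ polyC C k ∧ p.coeff α = 1 ∧ ∀ β ∈ p.support, β = α ∨ Grevlex β α}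

/-- The weighted sup norm `ν_k(p) = ‖w^k p‖_K`. -/
def weightedNorm (K : Set (Fin N → ℂ)) (w : (Fin N → ℂ) → ℝ) (k : ℕ)
    (p : MvPolynomial (Fin N) ℂ) : ℝ :=
  sSup ((fun z => w z ^ k * ‖MvPolynomial.eval z p‖) '' K)

/-- The discrete Chebyshev constant `T_k^≺(ν_k, α) = inf {ν_k(p)}^{1/k}`. -/
def discreteCheb (C : Set (Fin N → ℝ)) (K : Set (Fin N → ℂ)) (w : (Fin N → ℂ) → ℝ)
    (k : ℕ) (α : Fin N →₀ ℕ) : ℝ :=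
  sInf (weightedNorm K w k '' monicClass C k α) ^ (1 / (k : ℝ))

/-- The limiting process `k → ∞`, `α / k → θ` over all pairs with `α ∈ kC ∩ ℤ^N`. -/
def directionFilter (C : Set (Fin N → ℝ)) (θ : Fin N → ℝ) : Filter (ℕ × (Fin N →₀ ℕ)) :=
  comap Prod.fst atTop ⊓ comap (fun x => (x.1 : ℝ)⁻¹ • expVec x.2) (𝓝 θ) ⊓
    𝓟 {x | x.2 ∈ latticePoints C x.1}

/-- The directional Chebyshev constant `T^w_≺(K, θ)`. -/
def directionalCheb (C : Set (Fin N → ℝ)) (K : Set (Fin N → ℂ)) (w : (Fin N → ℂ) → ℝ)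
    (θ : Fin N → ℝ) : ℝ :=
  limUnder (directionFilter C θ) (fun x => discreteCheb C K w x.1 x.2)

/-- The Chebyshev transform `θ ↦ log T^w_≺(K, θ) ∈ [-∞, ∞)`, with `log 0 = -∞`. -/
def chebTransform (C : Set (Fin N → ℝ)) (K : Set (Fin N → ℂ)) (w : (Fin N → ℂ) → ℝ)
    (θ : Fin N → ℝ) : EReal :=
  ENNReal.log (ENNReal.ofReal (directionalCheb C K w θ))

/-- The Lebesgue integral of an extended real valued function, `∫ f⁺ - ∫ f⁻`
(meaningful when `f` is a.e. measurable and `∫ f⁺` is finite). -/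
def erealIntegral {X : Type*} [MeasurableSpace X] (f : X → EReal) (μ : Measure X) : EReal :=
  ((∫⁻ x, (f x).toENNReal ∂μ : ℝ≥0∞) : EReal) -
    ((∫⁻ x, (-f x).toENNReal ∂μ : ℝ≥0∞) : EReal)

/-- `M_k`, the number of points of `kC ∩ ℤ^N`. -/
def numPoints (C : Set (Fin N → ℝ)) (k : ℕ) : ℕ := Nat.card (latticePoints C k)

/-- `L_k`, the sum of the ordinary degrees of the monomials in `Poly(kC)`. -/
def degreeSum (C : Set (Fin N → ℝ)) (k : ℕ) : ℕ := ∑ᶠ α ∈ latticePoints C k, α.degree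

/-- The weighted Vandermonde matrix `[w(ζ_l)^k ζ_l^{α(j)}]_{j,l}`. -/
def vandermonde (w : (Fin N → ℂ) → ℝ) (k : ℕ) {s : ℕ} (a : Fin s → Fin N →₀ ℕ)
    (ζ : Fin s → Fin N → ℂ) : Matrix (Fin s) (Fin s) ℂ :=
  Matrix.of fun j l => ((w (ζ l) : ℝ) : ℂ) ^ k * ∏ i, ζ l i ^ a j i

/-- `V_k^w(K, s)`: the supremum over points of `K` of the modulus of the weighted Vandermonde
determinant formed with the exponents `a 0, …, a (s - 1)`. -/
def maxVandermonde (K : Set (Fin N → ℂ)) (w : (Fin N → ℂ) → ℝ) (k : ℕ) {s : ℕ}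
    (a : Fin s → Fin N →₀ ℕ) : ℝ :=
  sSup ((fun ζ => ‖(vandermonde w k a ζ).det‖) '' {ζ : Fin s → Fin N → ℂ | ∀ l, ζ l ∈ K})

/-- `V_k^w(K, M_k)`, for an enumeration `e` of `kC ∩ ℤ^N`. -/
def fullVandermonde (C : Set (Fin N → ℝ)) (K : Set (Fin N → ℂ)) (w : (Fin N → ℂ) → ℝ) (k : ℕ)
    (e : Fin (numPoints C k) ≃ latticePoints C k) : ℝ :=
  maxVandermonde K w k (fun j => (e j : Fin N →₀ ℕ))

/-- The `k`-th order `C`-diameter `V_k^w(K, M_k)^{1/L_k}`. -/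
def orderDiameter (C : Set (Fin N → ℝ)) (K : Set (Fin N → ℂ)) (w : (Fin N → ℂ) → ℝ) (k : ℕ)
    (e : Fin (numPoints C k) ≃ latticePoints C k) : ℝ :=
  fullVandermonde C K w k e ^ (1 / (degreeSum C k : ℝ))

/-- The weighted `C`-transfinite diameter `δ^w_C(K)`. -/
def transfiniteDiameter (C : Set (Fin N → ℝ)) (K : Set (Fin N → ℂ)) (w : (Fin N → ℂ) → ℝ)
    (e : ∀ k, Fin (numPoints C k) ≃ latticePoints C k) : ℝ :=
  limsup (fun k => orderDiameter C K w k (e k)) atTop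

/-- `vol_N(C)`. -/
def vol (C : Set (Fin N → ℝ)) : ℝ := (volume C).toReal

/-- `A_N = vol_N(C)⁻¹ ∫_C (θ₁ + ⋯ + θ_N) dθ`. -/
def normConst (C : Set (Fin N → ℝ)) : ℝ := (vol C)⁻¹ * ∫ θ in C, ∑ i, θ i

end ChebTransform

end

/-!
Let `τ_k(α)` (`minNorm`) be the infimum of the weighted sup norms over the monic class of `α`, so
that `T_k(α) = τ_k(α)^{1/k}`. Three facts carry the theorem.

*Vandermonde determinants.* Listing `kC ∩ ℤ^N` in increasing order, adding the last exponent
multiplies the maximal Vandermonde determinant by at least `τ_k` of that exponent (expand along the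
column of a free point) and by at most the number of exponents times `τ_k` (replace the last
monomial by a nearly optimal monic polynomial and expand along its row). Hence
`∏ τ_k(α) ≤ V_k ≤ M_k! ∏ τ_k(α)` (`prod_le_fullVandermonde_le`). Since `M_k` grows like `k^N`, the
factorial disappears in the root of order `k M_k`, and `V_k^{1/(k M_k)}` is asymptotically the
geometric mean of the numbers `T_k(α)`.

*Submultiplicativity.* The product of monic polynomials is monic for the sum of the exponents, and
`kC + lC = (k + l)C` by convexity, so `τ_{k+l}(α + β) ≤ τ_k(α) τ_l(β)`. For `θ` in the interior of
`C`, every `(n, γ)` with `γ / n` near `θ` is a multiple of a fixed `(k, α)` with `α / k` near `θ`,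
plus a comparatively small `(m, β)` with `β ∈ mC`; this gives the limit `T(θ)`
(`IsSubmultiplicative.exists_tendsto`). The same decomposition, with `α` an arbitrary exponent of
`kC` and a complement `β ∈ RkC` for a fixed large `R`, shows that if `T(θ) > 0` at a single interior
point then `T_k(α) ≥ c > 0` uniformly, boundary exponents included
(`IsSubmultiplicative.exists_pos_le_root`). So either all `log T_k(α)` are uniformly bounded, or
`T = 0` on the interior of `C`.

*Riemann sums.* Spreading the value at `α` over the cube of side `1 / k` at `α / k` turns a sum over
`kC ∩ ℤ^N` into the integral of a step function; the step functions converge off the null set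
`frontier C`, and dominated convergence applies to uniformly bounded summands
(`tendsto_latticeSum`). Applied to `1`, `|α| / k` and `log T_k(α)` this gives `M_k / k^N → vol C`,
`L_k / (k M_k) → A_N` and the integral formula in the bounded case. If `T = 0`, it is applied to
`log (max (T_k(α)) ρ)`, and `ρ → 0` gives `D = 0 = exp(-∞)`. The statement on `δ` follows by raising
to the power `k M_k / L_k → 1 / A_N`.
-/

namespace ChebTransform

variable {N : ℕ}

/-! ### The exponents and their ordering -/

lemma expVec_add (α β : Fin N →₀ ℕ) : expVec (α + β) = expVec α + expVec β := by
  ext i; simp [expVec]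

lemma expVec_nsmul (q : ℕ) (α : Fin N →₀ ℕ) : expVec (q • α) = (q : ℝ) • expVec α := by
  ext i; simp [expVec]

lemma grevlex_iff {α β : Fin N →₀ ℕ} : Grevlex α β ↔ toDegLex α < toDegLex β := by
  rw [Finsupp.DegLex.lt_iff, Finsupp.Lex.lt_iff]
  simp only [Grevlex, ofDegLex_toDegLex, ofLex_toLex]
  refine or_congr Iff.rfl (and_congr Iff.rfl (exists_congr fun m => ?_))
  tauto

lemma mem_monicClass {C : Set (Fin N → ℝ)} {k : ℕ} {α : Fin N →₀ ℕ}
    {p : MvPolynomial (Fin N) ℂ} :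
    p ∈ monicClass C k α ↔ ↑p.support ⊆ latticePoints C k ∧ p.coeff α = 1 ∧
      ∀ β ∈ p.support, toDegLex β ≤ toDegLex α := by
  refine and_congr Iff.rfl (and_congr Iff.rfl (forall₂_congr fun β _ => ?_))
  rw [le_iff_eq_or_lt, grevlex_iff, toDegLex_inj]

lemma add_mem_latticePoints {C : Set (Fin N → ℝ)} (hC : Convex ℝ C) {k l : ℕ}
    {α β : Fin N →₀ ℕ} (hα : α ∈ latticePoints C k) (hβ : β ∈ latticePoints C l) :
    α + β ∈ latticePoints C (k + l) := by
  change expVec _ ∈ ((k + l : ℕ) : ℝ) • C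
  rw [Nat.cast_add, hC.add_smul k.cast_nonneg l.cast_nonneg, expVec_add]
  exact Set.add_mem_add hα hβ

lemma finite_latticePoints {C : Set (Fin N → ℝ)} (hC : IsCompact C) (k : ℕ) :
    (latticePoints C k).Finite := by
  obtain ⟨r, hr⟩ := (hC.smul (k : ℝ)).isBounded.subset_closedBall 0
  refine (Set.finite_Iic (Finsupp.equivFunOnFinite.symm fun _ : Fin N => ⌊r⌋₊)).subset ?_
  intro α hα i
  refine Nat.le_floor (?_ : (α i : ℝ) ≤ r)
  have h := hr hα
  rw [mem_closedBall_zero_iff] at h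
  exact (le_abs_self _).trans ((norm_le_pi_norm (expVec α) i).trans h)

lemma monomial_mem_monicClass {C : Set (Fin N → ℝ)} {k : ℕ} {α : Fin N →₀ ℕ}
    (hα : α ∈ latticePoints C k) : MvPolynomial.monomial α (1 : ℂ) ∈ monicClass C k α := by
  refine ⟨(MvPolynomial.monomial_mem_restrictSupport ℂ).2 (Or.inl hα), by simp, fun β hβ => ?_⟩
  left
  simpa using MvPolynomial.support_monomial_subset hβ

lemma mul_mem_monicClass {C : Set (Fin N → ℝ)} (hC : Convex ℝ C) {k l : ℕ}
    {α β : Fin N →₀ ℕ} {p q : MvPolynomial (Fin N) ℂ} (hp : p ∈ monicClass C k α)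
    (hq : q ∈ monicClass C l β) : p * q ∈ monicClass C (k + l) (α + β) := by
  rw [mem_monicClass] at hp hq ⊢
  obtain ⟨hp1, hp2, hp3⟩ := hp
  obtain ⟨hq1, hq2, hq3⟩ := hq
  have hsupp : ∀ γ ∈ (p * q).support, ∃ a ∈ p.support, ∃ b ∈ q.support, a + b = γ := by
    intro γ hγ
    simpa [Finset.mem_add] using MvPolynomial.support_mul p q hγ
  refine ⟨?_, ?_, ?_⟩
  · intro γ hγ
    obtain ⟨a, ha, b, hb, rfl⟩ := hsupp γ hγ
    exact add_mem_latticePoints hC (hp1 ha) (hq1 hb)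
  · rw [MvPolynomial.coeff_mul, Finset.sum_eq_single (α, β), hp2, hq2, one_mul]
    · rintro ⟨a, b⟩ hab hne
      by_contra h0
      have hab' : a + b = α + β := by simpa using hab
      have ha := hp3 a (MvPolynomial.mem_support_iff.2 (left_ne_zero_of_mul h0))
      have hb := hq3 b (MvPolynomial.mem_support_iff.2 (right_ne_zero_of_mul h0))
      have hsum : toDegLex a + toDegLex b = toDegLex α + toDegLex β := by
        rw [← toDegLex_add, ← toDegLex_add, hab']
      obtain ⟨h1, h2⟩ := (add_eq_add_iff_eq_and_eq ha hb).1 hsum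
      exact hne (Prod.ext (toDegLex_inj.1 h1) (toDegLex_inj.1 h2))
    · intro h
      simp at h
  · intro γ hγ
    obtain ⟨a, ha, b, hb, rfl⟩ := hsupp γ hγ
    rw [toDegLex_add, toDegLex_add]
    exact add_le_add (hp3 a ha) (hq3 b hb)

/-! ### Minimal weighted norms of monic polynomials -/

/-- The infimum of the weighted norm over the monic class of `α`, the `k`-th power of the discrete
Chebyshev constant. -/
noncomputable def minNorm (C : Set (Fin N → ℝ)) (K : Set (Fin N → ℂ)) (w : (Fin N → ℂ) → ℝ)
    (k : ℕ) (α : Fin N →₀ ℕ) : ℝ :=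
  sInf (weightedNorm K w k '' monicClass C k α)

section Norm

variable {C : Set (Fin N → ℝ)} {K : Set (Fin N → ℂ)} {w : (Fin N → ℂ) → ℝ}

lemma bddAbove_weighted (hK : IsCompact K) (hw : ∀ z ∈ K, 0 ≤ w z) (hb : BddAbove (w '' K))
    (k : ℕ) (p : MvPolynomial (Fin N) ℂ) :
    BddAbove ((fun z => w z ^ k * ‖MvPolynomial.eval z p‖) '' K) := by
  obtain ⟨W, hW⟩ := hb
  obtain ⟨R, hR⟩ := hK.exists_bound_of_continuousOn (p.continuous_eval.continuousOn (s := K))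
  refine ⟨W ^ k * R, ?_⟩
  rintro _ ⟨z, hz, rfl⟩
  have h1 := hW ⟨z, hz, rfl⟩
  have h0 := hw z hz
  exact mul_le_mul (pow_le_pow_left₀ h0 h1 k) (hR z hz) (norm_nonneg _)
    (pow_nonneg (h0.trans h1) k)

lemma le_weightedNorm (hK : IsCompact K) (hw : ∀ z ∈ K, 0 ≤ w z) (hb : BddAbove (w '' K))
    (k : ℕ) (p : MvPolynomial (Fin N) ℂ) {z : Fin N → ℂ} (hz : z ∈ K) :
    w z ^ k * ‖MvPolynomial.eval z p‖ ≤ weightedNorm K w k p :=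
  le_csSup (bddAbove_weighted hK hw hb k p) ⟨z, hz, rfl⟩

lemma weightedNorm_le {k : ℕ} {p : MvPolynomial (Fin N) ℂ} {c : ℝ} (hc : 0 ≤ c)
    (h : ∀ z ∈ K, w z ^ k * ‖MvPolynomial.eval z p‖ ≤ c) : weightedNorm K w k p ≤ c := by
  refine Real.sSup_le ?_ hc
  rintro _ ⟨z, hz, rfl⟩
  exact h z hz

lemma weightedNorm_nonneg (hw : ∀ z ∈ K, 0 ≤ w z) (k : ℕ) (p : MvPolynomial (Fin N) ℂ) :
    0 ≤ weightedNorm K w k p := by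
  refine Real.sSup_nonneg ?_
  rintro _ ⟨z, hz, rfl⟩
  exact mul_nonneg (pow_nonneg (hw z hz) k) (norm_nonneg _)

lemma weightedNorm_mul_le (hK : IsCompact K) (hw : ∀ z ∈ K, 0 ≤ w z) (hb : BddAbove (w '' K))
    (k l : ℕ) (p q : MvPolynomial (Fin N) ℂ) :
    weightedNorm K w (k + l) (p * q) ≤ weightedNorm K w k p * weightedNorm K w l q := by
  refine weightedNorm_le
    (mul_nonneg (weightedNorm_nonneg hw k p) (weightedNorm_nonneg hw l q)) fun z hz => ?_
  have h1 := le_weightedNorm hK hw hb k p hz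
  have h2 := le_weightedNorm hK hw hb l q hz
  calc w z ^ (k + l) * ‖MvPolynomial.eval z (p * q)‖
      = (w z ^ k * ‖MvPolynomial.eval z p‖) * (w z ^ l * ‖MvPolynomial.eval z q‖) := by
        rw [map_mul, norm_mul, pow_add]; ring
    _ ≤ _ := mul_le_mul h1 h2 (mul_nonneg (pow_nonneg (hw z hz) l) (norm_nonneg _))
        (weightedNorm_nonneg hw k p)

lemma minNorm_nonneg (hw : ∀ z ∈ K, 0 ≤ w z) (k : ℕ) (α : Fin N →₀ ℕ) :
    0 ≤ minNorm C K w k α := by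
  refine Real.sInf_nonneg ?_
  rintro _ ⟨p, -, rfl⟩
  exact weightedNorm_nonneg hw k p

lemma minNorm_le (hw : ∀ z ∈ K, 0 ≤ w z) {k : ℕ} {α : Fin N →₀ ℕ} {p : MvPolynomial (Fin N) ℂ}
    (hp : p ∈ monicClass C k α) : minNorm C K w k α ≤ weightedNorm K w k p := by
  refine csInf_le ⟨0, ?_⟩ ⟨p, hp, rfl⟩
  rintro _ ⟨p, -, rfl⟩
  exact weightedNorm_nonneg hw k p

lemma le_sInf_mul {S : Set ℝ} (hS : S.Nonempty) {c t : ℝ} (hc : 0 ≤ c)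
    (h : ∀ x ∈ S, t ≤ x * c) : t ≤ sInf S * c := by
  rcases hc.eq_or_lt with rfl | hc
  · obtain ⟨x, hx⟩ := hS
    simpa using h x hx
  · rw [← div_le_iff₀ hc]
    exact le_csInf hS fun x hx => (div_le_iff₀ hc).2 (h x hx)

lemma le_minNorm_mul {k : ℕ} {α : Fin N →₀ ℕ} (hα : α ∈ latticePoints C k) {c t : ℝ}
    (hc : 0 ≤ c) (h : ∀ p ∈ monicClass C k α, t ≤ weightedNorm K w k p * c) :
    t ≤ minNorm C K w k α * c := by
  refine le_sInf_mul (Set.Nonempty.image _ ⟨_, monomial_mem_monicClass hα⟩) hc ?_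
  rintro _ ⟨p, hp, rfl⟩
  exact h p hp

lemma minNorm_add_le (hC : Convex ℝ C) (hK : IsCompact K) (hw : ∀ z ∈ K, 0 ≤ w z)
    (hb : BddAbove (w '' K)) {k l : ℕ} {α β : Fin N →₀ ℕ} (hα : α ∈ latticePoints C k)
    (hβ : β ∈ latticePoints C l) :
    minNorm C K w (k + l) (α + β) ≤ minNorm C K w k α * minNorm C K w l β := by
  refine le_minNorm_mul hα (minNorm_nonneg hw l β) fun p hp => ?_
  rw [mul_comm]
  refine le_minNorm_mul hβ (weightedNorm_nonneg hw k p) fun q hq => ?_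
  rw [mul_comm]
  exact (minNorm_le hw (mul_mem_monicClass hC hp hq)).trans (weightedNorm_mul_le hK hw hb k l p q)

lemma exists_minNorm_le_pow (hC : IsCompact C) (hK : IsCompact K) (hw : ∀ z ∈ K, 0 ≤ w z)
    (hb : BddAbove (w '' K)) :
    ∃ B : ℝ, 1 ≤ B ∧ ∀ k, ∀ α ∈ latticePoints C k, minNorm C K w k α ≤ B ^ k := by
  obtain ⟨W, hW⟩ := hb
  obtain ⟨R, hR⟩ := hK.isBounded.exists_norm_le
  obtain ⟨S, hS⟩ := hC.exists_bound_of_continuousOn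
    (f := fun θ : Fin N → ℝ => ∑ i, θ i) (by fun_prop)
  set W' := max 1 W
  set R' := max 1 R
  have hW1 : 1 ≤ W' := le_max_left _ _
  have hR1 : 1 ≤ R' := le_max_left _ _
  refine ⟨W' * R' ^ ⌈S⌉₊, one_le_mul_of_one_le_of_one_le hW1 (one_le_pow₀ hR1), ?_⟩
  intro k α hα
  refine (minNorm_le hw (monomial_mem_monicClass hα)).trans ?_
  have hdeg : ∑ i, α i ≤ ⌈S⌉₊ * k := by
    obtain ⟨θ, hθ, hθα⟩ := hα
    have h1 : ((∑ i, α i : ℕ) : ℝ) = k * ∑ i, θ i := by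
      rw [Nat.cast_sum, Finset.mul_sum]
      exact Finset.sum_congr rfl fun i _ => (congrFun hθα i).symm
    have h2 : ∑ i, θ i ≤ ⌈S⌉₊ := (le_abs_self _).trans ((hS θ hθ).trans (Nat.le_ceil S))
    have h3 : ((∑ i, α i : ℕ) : ℝ) ≤ (⌈S⌉₊ * k : ℕ) := by
      rw [h1, Nat.cast_mul, mul_comm]
      exact mul_le_mul_of_nonneg_right h2 k.cast_nonneg
    exact_mod_cast h3
  refine weightedNorm_le (by positivity) fun z hz => ?_
  have hWz : w z ≤ W' := (hW ⟨z, hz, rfl⟩).trans (le_max_right _ _)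
  have hmon : ‖MvPolynomial.eval z (MvPolynomial.monomial α (1 : ℂ))‖ ≤ (R' ^ ⌈S⌉₊) ^ k := by
    rw [MvPolynomial.eval_monomial, one_mul, Finsupp.prod_fintype _ _ (by simp), norm_prod]
    calc ∏ i, ‖z i ^ α i‖ ≤ ∏ i, R' ^ α i := by
          refine Finset.prod_le_prod (fun _ _ => norm_nonneg _) fun i _ => ?_
          rw [norm_pow]
          exact pow_le_pow_left₀ (norm_nonneg _)
            ((norm_le_pi_norm z i).trans ((hR z hz).trans (le_max_right _ _))) _
      _ = R' ^ ∑ i, α i := Finset.prod_pow_eq_pow_sum _ _ _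
      _ ≤ R' ^ (⌈S⌉₊ * k) := pow_le_pow_right₀ hR1 hdeg
      _ = _ := pow_mul _ _ _
  rw [mul_pow]
  exact mul_le_mul (pow_le_pow_left₀ (hw z hz) hWz k) hmon (norm_nonneg _) (by positivity)

end Norm

/-! ### Vandermonde determinants and products of minimal norms -/

section Vandermonde

variable {C : Set (Fin N → ℝ)} {K : Set (Fin N → ℂ)} {w : (Fin N → ℂ) → ℝ}

lemma eval_monomial_one (z : Fin N → ℂ) (α : Fin N →₀ ℕ) :
    MvPolynomial.eval z (MvPolynomial.monomial α (1 : ℂ)) = ∏ i, z i ^ α i := by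
  rw [MvPolynomial.eval_monomial, one_mul, Finsupp.prod_fintype _ _ (by simp)]

lemma bddAbove_vandermonde (hK : IsCompact K) (hw : ∀ z ∈ K, 0 ≤ w z) (hb : BddAbove (w '' K))
    (k : ℕ) {s : ℕ} (a : Fin s → Fin N →₀ ℕ) :
    BddAbove ((fun ζ => ‖(vandermonde w k a ζ).det‖) ''
      {ζ : Fin s → Fin N → ℂ | ∀ l, ζ l ∈ K}) := by
  refine ⟨∑ _σ : Equiv.Perm (Fin s), ∏ i,
    weightedNorm K w k (MvPolynomial.monomial (a i) 1), ?_⟩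
  rintro _ ⟨ζ, hζ, rfl⟩
  dsimp only
  rw [← Matrix.det_transpose, Matrix.det_apply]
  refine (norm_sum_le _ _).trans (Finset.sum_le_sum fun σ _ => ?_)
  have hsign : ‖(Equiv.Perm.sign σ) • ∏ i, (vandermonde w k a ζ).transpose (σ i) i‖ =
      ‖∏ i, (vandermonde w k a ζ).transpose (σ i) i‖ := by
    rcases Int.units_eq_one_or (Equiv.Perm.sign σ) with h | h <;> simp [h]
  rw [hsign, norm_prod]
  refine Finset.prod_le_prod (fun _ _ => norm_nonneg _) fun i _ => ?_
  have h := le_weightedNorm hK hw hb k (MvPolynomial.monomial (a i) 1) (hζ (σ i))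
  rw [eval_monomial_one] at h
  simpa [vandermonde, abs_of_nonneg (hw _ (hζ (σ i)))] using h

lemma le_maxVandermonde (hK : IsCompact K) (hw : ∀ z ∈ K, 0 ≤ w z) (hb : BddAbove (w '' K))
    (k : ℕ) {s : ℕ} (a : Fin s → Fin N →₀ ℕ) {ζ : Fin s → Fin N → ℂ} (hζ : ∀ l, ζ l ∈ K) :
    ‖(vandermonde w k a ζ).det‖ ≤ maxVandermonde K w k a :=
  le_csSup (bddAbove_vandermonde hK hw hb k a) ⟨ζ, hζ, rfl⟩

lemma maxVandermonde_nonneg (k : ℕ) {s : ℕ} (a : Fin s → Fin N →₀ ℕ) :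
    0 ≤ maxVandermonde K w k a := by
  refine Real.sSup_nonneg ?_
  rintro _ ⟨ζ, -, rfl⟩
  exact norm_nonneg _

lemma maxVandermonde_le {k : ℕ} {s : ℕ} {a : Fin s → Fin N →₀ ℕ} {c : ℝ} (hc : 0 ≤ c)
    (h : ∀ ζ : Fin s → Fin N → ℂ, (∀ l, ζ l ∈ K) → ‖(vandermonde w k a ζ).det‖ ≤ c) :
    maxVandermonde K w k a ≤ c := by
  refine Real.sSup_le ?_ hc
  rintro _ ⟨ζ, hζ, rfl⟩
  exact h ζ hζ

lemma maxVandermonde_zero (k : ℕ) (a : Fin 0 → Fin N →₀ ℕ) : maxVandermonde K w k a = 1 := by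
  simp [maxVandermonde]

lemma maxVandermonde_comp_perm (k : ℕ) {s : ℕ} (a : Fin s → Fin N →₀ ℕ)
    (σ : Equiv.Perm (Fin s)) : maxVandermonde K w k (a ∘ σ) = maxVandermonde K w k a := by
  unfold maxVandermonde
  congr 1
  refine Set.image_congr fun ζ _ => ?_
  have h : vandermonde w k (a ∘ σ) ζ = (vandermonde w k a ζ).submatrix σ id := rfl
  rw [h, Matrix.det_permute]
  rcases Int.units_eq_one_or (Equiv.Perm.sign σ) with h | h <;> simp [h]

/-- The exponents `a` lie in `kC`, are listed in increasing order, and no exponent of `kC` is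
skipped. -/
structure IsInitialSegment (C : Set (Fin N → ℝ)) (k : ℕ) {s : ℕ} (a : Fin s → Fin N →₀ ℕ) :
    Prop where
  mem : ∀ j, a j ∈ latticePoints C k
  strictMono : StrictMono fun j => toDegLex (a j)
  mem_range : ∀ j, ∀ β ∈ latticePoints C k, toDegLex β ≤ toDegLex (a j) → β ∈ Set.range a

lemma IsInitialSegment.init {k s : ℕ} {a : Fin (s + 1) → Fin N →₀ ℕ}
    (h : IsInitialSegment C k a) : IsInitialSegment C k (fun j : Fin s => a j.castSucc) where
  mem j := h.mem _
  strictMono i j hij := h.strictMono (Fin.castSucc_lt_castSucc_iff.2 hij)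
  mem_range j β hβ hle := by
    obtain ⟨i, rfl⟩ := h.mem_range _ β hβ hle
    have hij : i ≤ j.castSucc := h.strictMono.le_iff_le.1 hle
    have hi : i ≠ Fin.last s := (hij.trans_lt (Fin.castSucc_lt_last j)).ne
    exact ⟨i.castPred hi, by simp⟩

/-- Expanding the determinant along the column of a free point `z` exhibits it as a multiple of a
monic polynomial in `z`; the factor is the smaller Vandermonde determinant. -/
lemma minNorm_mul_maxVandermonde_le (hK : IsCompact K) (hw : ∀ z ∈ K, 0 ≤ w z)
    (hb : BddAbove (w '' K)) {k s : ℕ} {a : Fin (s + 1) → Fin N →₀ ℕ}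
    (ha : IsInitialSegment C k a) :
    minNorm C K w k (a (Fin.last s)) * maxVandermonde K w k (fun j : Fin s => a j.castSucc) ≤
      maxVandermonde K w k a := by
  have hV0 := maxVandermonde_nonneg (K := K) (w := w) k a
  have hτ0 := minNorm_nonneg (C := C) hw k (a (Fin.last s))
  have key : ∀ ζ : Fin s → Fin N → ℂ, (∀ l, ζ l ∈ K) →
      minNorm C K w k (a (Fin.last s)) *
        ‖(vandermonde w k (fun j : Fin s => a j.castSucc) ζ).det‖ ≤ maxVandermonde K w k a := by
    intro ζ hζ
    set Δ := (vandermonde w k (fun j : Fin s => a j.castSucc) ζ).det with hΔ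
    by_cases hΔ0 : Δ = 0
    · simpa [hΔ0] using hV0
    -- the cofactors of the last column
    let c : Fin (s + 1) → ℂ := fun j =>
      (-1) ^ (j + Fin.last s : ℕ) * (vandermonde w k (fun i => a (j.succAbove i)) ζ).det
    have hc : c (Fin.last s) = Δ := by
      simp only [c, Fin.succAbove_last, Fin.val_last, ← two_mul, pow_mul]
      simp [hΔ]
    let p : MvPolynomial (Fin N) ℂ := ∑ j, MvPolynomial.monomial (a j) (Δ⁻¹ * c j)
    have hinj : Function.Injective a := fun i j hij =>
      ha.strictMono.injective (congrArg toDegLex hij)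
    have hcoeff : ∀ j, p.coeff (a j) = Δ⁻¹ * c j := by
      intro j
      simp only [p, MvPolynomial.coeff_sum, MvPolynomial.coeff_monomial, hinj.eq_iff]
      simp
    have hsupp : ∀ β ∈ p.support, ∃ j, β = a j := by
      intro β hβ
      by_contra! hne
      refine MvPolynomial.mem_support_iff.1 hβ ?_
      simp only [p, MvPolynomial.coeff_sum, MvPolynomial.coeff_monomial]
      exact Finset.sum_eq_zero fun j _ => if_neg (hne j).symm
    have hp : p ∈ monicClass C k (a (Fin.last s)) := by
      rw [mem_monicClass]
      refine ⟨fun β hβ => ?_, ?_, fun β hβ => ?_⟩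
      · obtain ⟨j, rfl⟩ := hsupp β hβ
        exact ha.mem j
      · rw [hcoeff, hc, inv_mul_cancel₀ hΔ0]
      · obtain ⟨j, rfl⟩ := hsupp β hβ
        exact ha.strictMono.monotone (Fin.le_last j)
    have hnorm : weightedNorm K w k p ≤ ‖Δ‖⁻¹ * maxVandermonde K w k a := by
      refine weightedNorm_le (by positivity) fun z hz => ?_
      have hmem : ∀ l, (Fin.snoc ζ z : Fin (s + 1) → Fin N → ℂ) l ∈ K := by
        intro l
        refine Fin.lastCases ?_ (fun i => ?_) l
        · simpa using hz
        · simpa using hζ i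
      have hV := le_maxVandermonde hK hw hb k a hmem
      have hdet : (vandermonde w k a (Fin.snoc ζ z : Fin (s + 1) → Fin N → ℂ)).det =
          Δ * ((w z : ℂ) ^ k * MvPolynomial.eval z p) := by
        rw [Matrix.det_succ_column _ (Fin.last s)]
        simp only [p, map_sum, MvPolynomial.eval_monomial, Finset.mul_sum]
        refine Finset.sum_congr rfl fun j _ => ?_
        have hsub : (vandermonde w k a (Fin.snoc ζ z : Fin (s + 1) → Fin N → ℂ)).submatrix
            j.succAbove (Fin.last s).succAbove =
              vandermonde w k (fun i => a (j.succAbove i)) ζ := by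
          ext i l
          simp [vandermonde]
        rw [hsub, Finsupp.prod_fintype _ _ (by simp)]
        simp only [c, vandermonde, Matrix.of_apply, Fin.snoc_last]
        field_simp
      rw [hdet, norm_mul, norm_mul, norm_pow, Complex.norm_real,
        Real.norm_of_nonneg (hw z hz)] at hV
      rw [inv_mul_eq_div, le_div_iff₀ (norm_pos_iff.2 hΔ0), mul_comm]
      exact hV
    have := (minNorm_le hw hp).trans hnorm
    rwa [inv_mul_eq_div, le_div_iff₀ (norm_pos_iff.2 hΔ0)] at this
  rcases hτ0.eq_or_lt with h0 | h0
  · rwa [← h0, zero_mul]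
  · rw [mul_comm, ← le_div_iff₀ h0]
    refine maxVandermonde_le (by positivity) fun ζ hζ => ?_
    rw [le_div_iff₀ h0, mul_comm]
    exact key ζ hζ

/-- Row operations replace the last monomial by any monic polynomial; the determinant is then
expanded along that row. -/
lemma maxVandermonde_le_mul_minNorm (hK : IsCompact K) (hw : ∀ z ∈ K, 0 ≤ w z)
    (hb : BddAbove (w '' K)) {k s : ℕ} {a : Fin (s + 1) → Fin N →₀ ℕ}
    (ha : IsInitialSegment C k a) :
    maxVandermonde K w k a ≤ (s + 1) *
      (minNorm C K w k (a (Fin.last s)) *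
        maxVandermonde K w k (fun j : Fin s => a j.castSucc)) := by
  have hV0 := maxVandermonde_nonneg (K := K) (w := w) k (fun j : Fin s => a j.castSucc)
  set V := maxVandermonde K w k (fun j : Fin s => a j.castSucc) with hV
  rw [mul_left_comm]
  refine le_minNorm_mul (ha.mem _) (by positivity) fun p hp => ?_
  have hp0 := weightedNorm_nonneg hw k p
  refine maxVandermonde_le (by positivity) fun ζ hζ => ?_
  rw [mem_monicClass] at hp
  obtain ⟨hp1, hp2, hp3⟩ := hp
  have hinj : Function.Injective a := fun i j hij =>
    ha.strictMono.injective (congrArg toDegLex hij)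
  have heval : ∀ z, MvPolynomial.eval z p = ∑ j, p.coeff (a j) * ∏ i, z i ^ a j i := by
    intro z
    rw [MvPolynomial.eval_eq', ← Finset.sum_image (s := Finset.univ) (g := a)
      (f := fun d => p.coeff d * ∏ i, z i ^ d i) (fun i _ j _ h => hinj h)]
    refine Finset.sum_subset (fun β hβ => ?_) fun β _ hβ => ?_
    · obtain ⟨j, rfl⟩ := ha.mem_range (Fin.last s) β (hp1 hβ) (hp3 β hβ)
      simp
    · rw [MvPolynomial.notMem_support_iff.1 hβ, zero_mul]
  set A := vandermonde w k a ζ with hA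
  have hrow : A.updateRow (Fin.last s) (∑ j, p.coeff (a j) • A j) =
      A.updateRow (Fin.last s) (fun l => (w (ζ l) : ℂ) ^ k * MvPolynomial.eval (ζ l) p) := by
    congr 1
    ext l
    rw [heval, Finset.mul_sum, Finset.sum_apply]
    refine Finset.sum_congr rfl fun j _ => ?_
    simp only [Pi.smul_apply, smul_eq_mul, hA, vandermonde, Matrix.of_apply]
    ring
  have hdet : A.det =
      (A.updateRow (Fin.last s)
        (fun l => (w (ζ l) : ℂ) ^ k * MvPolynomial.eval (ζ l) p)).det := by
    rw [← hrow, Matrix.det_updateRow_sum, hp2, one_smul]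
  rw [hdet, Matrix.det_succ_row _ (Fin.last s)]
  refine (norm_sum_le _ _).trans ?_
  have hterm : ∀ l : Fin (s + 1), ‖(-1 : ℂ) ^ ((Fin.last s : ℕ) + l) *
      A.updateRow (Fin.last s)
        (fun l => (w (ζ l) : ℂ) ^ k * MvPolynomial.eval (ζ l) p) (Fin.last s) l *
      ((A.updateRow (Fin.last s)
        (fun l => (w (ζ l) : ℂ) ^ k * MvPolynomial.eval (ζ l) p)).submatrix
          (Fin.last s).succAbove l.succAbove).det‖ ≤ weightedNorm K w k p * V := by
    intro l
    have hsub : (A.updateRow (Fin.last s)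
        (fun l => (w (ζ l) : ℂ) ^ k * MvPolynomial.eval (ζ l) p)).submatrix
          (Fin.last s).succAbove l.succAbove =
        vandermonde w k (fun j : Fin s => a j.castSucc) (fun i => ζ (l.succAbove i)) := by
      ext i j
      simp [hA, vandermonde]
    rw [hsub, Matrix.updateRow_self, norm_mul, norm_mul, norm_pow, norm_neg, norm_one, one_pow,
      one_mul]
    refine mul_le_mul ?_ (le_maxVandermonde hK hw hb k _ fun i => hζ _) (norm_nonneg _) hp0
    rw [norm_mul, norm_pow, Complex.norm_real, Real.norm_of_nonneg (hw _ (hζ l))]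
    exact le_weightedNorm hK hw hb k p (hζ l)
  refine (Finset.sum_le_sum fun l _ => hterm l).trans (le_of_eq ?_)
  simp only [Finset.sum_const, Finset.card_univ, Fintype.card_fin, nsmul_eq_mul]
  push_cast
  ring

lemma IsInitialSegment.prod_le_maxVandermonde_le (hK : IsCompact K) (hw : ∀ z ∈ K, 0 ≤ w z)
    (hb : BddAbove (w '' K)) {k : ℕ} : ∀ {s : ℕ} {a : Fin s → Fin N →₀ ℕ},
    IsInitialSegment C k a →
      ∏ j, minNorm C K w k (a j) ≤ maxVandermonde K w k a ∧
      maxVandermonde K w k a ≤ s.factorial * ∏ j, minNorm C K w k (a j) := by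
  intro s
  induction s with
  | zero => intro a _; simp [maxVandermonde_zero]
  | succ s ih =>
    intro a ha
    obtain ⟨h1, h2⟩ := ih ha.init
    have hτ := minNorm_nonneg (C := C) hw k (a (Fin.last s))
    rw [Fin.prod_univ_castSucc]
    constructor
    · refine le_trans ?_ (minNorm_mul_maxVandermonde_le hK hw hb ha)
      rw [mul_comm]
      exact mul_le_mul_of_nonneg_left h1 hτ
    · refine (maxVandermonde_le_mul_minNorm hK hw hb ha).trans ?_
      calc _ ≤ ((s : ℝ) + 1) * (minNorm C K w k (a (Fin.last s)) *
            (s.factorial * ∏ j : Fin s, minNorm C K w k (a j.castSucc))) := by gcongr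
        _ = _ := by rw [Nat.factorial_succ]; push_cast; ring

/-- The Vandermonde maximum of `Poly(kC)` agrees with the product of the minimal norms, up to the
factor `M_k!`. -/
lemma prod_le_fullVandermonde_le (hC : IsCompact C) (hK : IsCompact K) (hw : ∀ z ∈ K, 0 ≤ w z)
    (hb : BddAbove (w '' K)) (k : ℕ) (e : Fin (numPoints C k) ≃ latticePoints C k) :
    ∏ α ∈ (finite_latticePoints hC k).toFinset, minNorm C K w k α ≤ fullVandermonde C K w k e ∧
      fullVandermonde C K w k e ≤ (numPoints C k).factorial *
        ∏ α ∈ (finite_latticePoints hC k).toFinset, minNorm C K w k α := by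
  set b : Fin (numPoints C k) → Fin N →₀ ℕ := fun j => (e j : Fin N →₀ ℕ) with hbdef
  set σ := Tuple.sort fun j => toDegLex (b j)
  have hb_inj : Function.Injective b := Subtype.val_injective.comp e.injective
  have hrange : ∀ β ∈ latticePoints C k, ∃ j, b (σ j) = β := fun β hβ =>
    ⟨σ.symm (e.symm ⟨β, hβ⟩), by simp [hbdef]⟩
  have hseg : IsInitialSegment C k (b ∘ σ) :=
    { mem := fun j => (e (σ j)).2
      strictMono := (Tuple.monotone_sort fun j => toDegLex (b j)).strictMono_of_injective
        (hb_inj.comp σ.injective)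
      mem_range := fun j β hβ _ => hrange β hβ }
  have hprod : ∏ j, minNorm C K w k ((b ∘ σ) j) =
      ∏ α ∈ (finite_latticePoints hC k).toFinset, minNorm C K w k α := by
    refine Finset.prod_bij (fun j _ => b (σ j)) (fun j _ => ?_)
      (fun i _ j _ h => σ.injective (hb_inj h)) (fun β hβ => ?_) fun _ _ => rfl
    · exact (Set.Finite.mem_toFinset _).2 (e (σ j)).2
    · obtain ⟨j, hj⟩ := hrange β (by simpa using hβ)
      exact ⟨j, Finset.mem_univ _, hj⟩
  have h := hseg.prod_le_maxVandermonde_le hK hw hb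
  rwa [maxVandermonde_comp_perm, hprod] at h

end Vandermonde

/-! ### Lattice points near a ray -/

lemma eventually_directionFilter {C : Set (Fin N → ℝ)} {θ : Fin N → ℝ}
    {P : ℕ × (Fin N →₀ ℕ) → Prop} :
    (∀ᶠ x in directionFilter C θ, P x) ↔ ∃ δ : ℝ, 0 < δ ∧ ∃ n₀ : ℕ, ∀ n ≥ n₀, 0 < n →
      ∀ γ ∈ latticePoints C n, ‖expVec γ - (n : ℝ) • θ‖ < δ * n → P (n, γ) := by
  have hnorm : ∀ n : ℕ, 0 < n → ∀ γ : Fin N →₀ ℕ, ∀ δ : ℝ,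
      ‖(n : ℝ)⁻¹ • expVec γ - θ‖ < δ ↔ ‖expVec γ - (n : ℝ) • θ‖ < δ * n := by
    intro n hn γ δ
    have hn' : (0 : ℝ) < n := Nat.cast_pos.2 hn
    have h : (n : ℝ)⁻¹ • expVec γ - θ = (n : ℝ)⁻¹ • (expVec γ - (n : ℝ) • θ) := by
      rw [smul_sub, inv_smul_smul₀ hn'.ne']
    rw [h, norm_smul, norm_inv, Real.norm_of_nonneg hn'.le, inv_mul_eq_div, div_lt_iff₀ hn']
  have hbasis := ((atTop_basis.comap (Prod.fst : ℕ × (Fin N →₀ ℕ) → ℕ)).inf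
    ((Metric.nhds_basis_ball (x := θ)).comap
      (fun x : ℕ × (Fin N →₀ ℕ) => (x.1 : ℝ)⁻¹ • expVec x.2))).inf_principal
      {x | x.2 ∈ latticePoints C x.1}
  rw [directionFilter, hbasis.eventually_iff]
  constructor
  · rintro ⟨⟨n₀, δ⟩, ⟨-, hδ⟩, h⟩
    refine ⟨δ, hδ, n₀, fun n hn hn0 γ hγ hd => @h (n, γ) ⟨⟨hn, ?_⟩, hγ⟩⟩
    exact mem_ball_iff_norm.2 ((hnorm n hn0 γ δ).2 hd)
  · rintro ⟨δ, hδ, n₀, h⟩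
    refine ⟨⟨n₀ + 1, δ⟩, ⟨trivial, hδ⟩, ?_⟩
    rintro ⟨n, γ⟩ ⟨⟨hn, hd⟩, hγ⟩
    have hn' : n₀ + 1 ≤ n := hn
    exact h n (by omega) (by omega) γ hγ ((hnorm n (by omega) γ δ).1 (mem_ball_iff_norm.1 hd))

/-- The coordinatewise integer part of `nθ`. -/
noncomputable def floorVec (n : ℕ) (θ : Fin N → ℝ) : Fin N →₀ ℕ :=
  Finsupp.equivFunOnFinite.symm fun i => ⌊(n : ℝ) * θ i⌋₊

lemma floorVec_apply (n : ℕ) (θ : Fin N → ℝ) (i : Fin N) : floorVec n θ i = ⌊(n : ℝ) * θ i⌋₊ := rfl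

lemma norm_floorVec_sub_le {θ : Fin N → ℝ} (hθ : ∀ i, 0 ≤ θ i) (n : ℕ) :
    ‖expVec (floorVec n θ) - (n : ℝ) • θ‖ ≤ 1 := by
  refine (pi_norm_le_iff_of_nonneg zero_le_one).2 fun i => ?_
  have h1 := Nat.floor_le (mul_nonneg n.cast_nonneg (hθ i) : 0 ≤ (n : ℝ) * θ i)
  have h2 := Nat.lt_floor_add_one ((n : ℝ) * θ i)
  simp only [Pi.sub_apply, expVec, floorVec_apply, Pi.smul_apply, smul_eq_mul, Real.norm_eq_abs,
    abs_le]
  constructor <;> linarith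

lemma mem_latticePoints_of_norm_lt {C : Set (Fin N → ℝ)} {θ : Fin N → ℝ} {ρ : ℝ}
    (hρ : Metric.ball θ ρ ⊆ C) {n : ℕ} (hn : 0 < n) {γ : Fin N →₀ ℕ}
    (h : ‖expVec γ - (n : ℝ) • θ‖ < ρ * n) : γ ∈ latticePoints C n := by
  have hn' : (0 : ℝ) < n := Nat.cast_pos.2 hn
  refine ⟨(n : ℝ)⁻¹ • expVec γ, hρ (mem_ball_iff_norm.2 ?_), smul_inv_smul₀ hn'.ne' _⟩
  have h' : (n : ℝ)⁻¹ • expVec γ - θ = (n : ℝ)⁻¹ • (expVec γ - (n : ℝ) • θ) := by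
    rw [smul_sub, inv_smul_smul₀ hn'.ne']
  rwa [h', norm_smul, norm_inv, Real.norm_of_nonneg hn'.le, inv_mul_eq_div, div_lt_iff₀ hn']

/-- If `γ` is close to `(qk + m)θ` and `α` is close to `kθ`, the remainder `γ - qα` is an exponent
of `mC`. -/
lemma exists_eq_nsmul_add {C : Set (Fin N → ℝ)} (hnn : ∀ x ∈ C, ∀ i, 0 ≤ x i) {θ : Fin N → ℝ}
    {ρ : ℝ} (hρ : Metric.ball θ ρ ⊆ C) {k m q : ℕ} (hm : 0 < m) {α γ : Fin N →₀ ℕ}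
    (h : ‖expVec γ - ((q * k + m : ℕ) : ℝ) • θ‖ + q * ‖expVec α - (k : ℝ) • θ‖ < ρ * m) :
    ∃ β ∈ latticePoints C m, γ = q • α + β := by
  have hm' : (0 : ℝ) < m := Nat.cast_pos.2 hm
  set v : Fin N → ℝ := expVec γ - (q : ℝ) • expVec α with hv
  have hvθ : ‖v - (m : ℝ) • θ‖ < ρ * m := by
    have h1 : v - (m : ℝ) • θ = (expVec γ - ((q * k + m : ℕ) : ℝ) • θ) -
        (q : ℝ) • (expVec α - (k : ℝ) • θ) := by
      rw [hv]; push_cast; module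
    rw [h1]
    refine (norm_sub_le _ _).trans_lt ?_
    rwa [norm_smul, Real.norm_of_nonneg q.cast_nonneg]
  have hmem : (m : ℝ)⁻¹ • v ∈ C := by
    refine hρ (mem_ball_iff_norm.2 ?_)
    have h' : (m : ℝ)⁻¹ • v - θ = (m : ℝ)⁻¹ • (v - (m : ℝ) • θ) := by
      rw [smul_sub _ v, inv_smul_smul₀ hm'.ne']
    rwa [h', norm_smul, norm_inv, Real.norm_of_nonneg hm'.le, inv_mul_eq_div, div_lt_iff₀ hm']
  have hle : q • α ≤ γ := by
    intro i
    have h0 := hnn _ hmem i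
    rw [Pi.smul_apply, smul_eq_mul, mul_nonneg_iff_of_pos_left (inv_pos.2 hm')] at h0
    have h1 : (q : ℝ) * α i ≤ γ i := by simpa [hv, expVec] using h0
    exact_mod_cast h1
  have hγ : γ = q • α + (γ - q • α) := (add_tsub_cancel_of_le hle).symm
  refine ⟨γ - q • α, ⟨_, hmem, ?_⟩, hγ⟩
  change (m : ℝ) • (m : ℝ)⁻¹ • v = _
  rw [smul_inv_smul₀ hm'.ne', hv, sub_eq_iff_eq_add, ← expVec_nsmul, ← expVec_add, add_comm, ← hγ]

lemma tendsto_floorVec {C : Set (Fin N → ℝ)} (hnn : ∀ x ∈ C, ∀ i, 0 ≤ x i) {θ : Fin N → ℝ}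
    (hθ : θ ∈ interior C) :
    Tendsto (fun n : ℕ => (n, floorVec n θ)) atTop (directionFilter C θ) := by
  obtain ⟨ρ, hρ, hball⟩ := Metric.mem_nhds_iff.1 (mem_interior_iff_mem_nhds.1 hθ)
  have hθ0 := hnn θ (interior_subset hθ)
  intro S hS
  obtain ⟨δ, hδ, n₀, h⟩ := eventually_directionFilter.1 hS
  have hlin : ∀ c : ℝ, 0 < c → ∀ᶠ n : ℕ in atTop, 1 < c * n := fun c hc =>
    (tendsto_natCast_atTop_atTop.const_mul_atTop hc).eventually_gt_atTop 1
  change ∀ᶠ n : ℕ in atTop, (n, floorVec n θ) ∈ S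
  filter_upwards [hlin ρ hρ, hlin δ hδ, eventually_ge_atTop n₀, eventually_gt_atTop 0]
    with n h1 h2 h3 h4
  have hd := norm_floorVec_sub_le hθ0 n
  exact h n h3 h4 _ (mem_latticePoints_of_norm_lt hball h4 (hd.trans_lt h1)) (hd.trans_lt h2)

lemma directionFilter_neBot {C : Set (Fin N → ℝ)} (hnn : ∀ x ∈ C, ∀ i, 0 ≤ x i) {θ : Fin N → ℝ}
    (hθ : θ ∈ interior C) : (directionFilter C θ).NeBot :=
  (tendsto_floorVec hnn hθ).neBot

/-! ### Submultiplicative families of exponents -/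

lemma root_pow {x : ℝ} (hx : 0 ≤ x) {k : ℕ} (hk : 0 < k) : (x ^ (1 / (k : ℝ))) ^ k = x := by
  rw [one_div, Real.rpow_inv_natCast_pow hx hk.ne']

lemma root_le_iff {x c : ℝ} (hx : 0 ≤ x) (hc : 0 ≤ c) {k : ℕ} (hk : 0 < k) :
    x ^ (1 / (k : ℝ)) ≤ c ↔ x ≤ c ^ k := by
  conv_rhs => rw [← root_pow hx hk]
  exact (pow_le_pow_iff_left₀ (Real.rpow_nonneg hx _) hc hk.ne').symm

lemma le_root_iff {x c : ℝ} (hx : 0 ≤ x) (hc : 0 ≤ c) {k : ℕ} (hk : 0 < k) :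
    c ≤ x ^ (1 / (k : ℝ)) ↔ c ^ k ≤ x := by
  conv_rhs => rw [← root_pow hx hk]
  exact (pow_le_pow_iff_left₀ hc (Real.rpow_nonneg hx _) hk.ne').symm

/-- A nonnegative submultiplicative function on the semigroup of pairs `(k, α)` with `α ∈ kC`, of
at most geometric growth in `k`. -/
structure IsSubmultiplicative (C : Set (Fin N → ℝ)) (τ : ℕ → (Fin N →₀ ℕ) → ℝ) (B : ℝ) :
    Prop where
  nonneg : ∀ k α, 0 ≤ τ k α
  one_le : 1 ≤ B
  le_pow : ∀ k, ∀ α ∈ latticePoints C k, τ k α ≤ B ^ k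
  add_le : ∀ k l, ∀ α ∈ latticePoints C k, ∀ β ∈ latticePoints C l,
    τ (k + l) (α + β) ≤ τ k α * τ l β

namespace IsSubmultiplicative

variable {C : Set (Fin N → ℝ)} {τ : ℕ → (Fin N →₀ ℕ) → ℝ} {B : ℝ}

lemma root_le (h : IsSubmultiplicative C τ B) {k : ℕ} (hk : 0 < k) {α : Fin N →₀ ℕ}
    (hα : α ∈ latticePoints C k) : τ k α ^ (1 / (k : ℝ)) ≤ B :=
  (root_le_iff (h.nonneg k α) (zero_le_one.trans h.one_le) hk).2 (h.le_pow k α hα)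

lemma nsmul_add_le (h : IsSubmultiplicative C τ B) (hC : Convex ℝ C) {k m : ℕ}
    {α β : Fin N →₀ ℕ} (hα : α ∈ latticePoints C k) (hβ : β ∈ latticePoints C m) (q : ℕ) :
    q • α + β ∈ latticePoints C (q * k + m) ∧
      τ (q * k + m) (q • α + β) ≤ τ k α ^ q * τ m β := by
  induction q with
  | zero => simpa using hβ
  | succ q ih =>
    have h1 : (q + 1) • α + β = α + (q • α + β) := by rw [succ_nsmul]; abel
    have h2 : (q + 1) * k + m = k + (q * k + m) := by ring
    rw [h1, h2]
    refine ⟨add_mem_latticePoints hC hα ih.1, (h.add_le _ _ _ hα _ ih.1).trans ?_⟩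
    rw [pow_succ', mul_assoc]
    exact mul_le_mul_of_nonneg_left ih.2 (h.nonneg k α)

/-- The heart of the existence of directional limits: a single pair `(k, α)` in a direction near
`θ` controls all pairs `(n, γ)` with `n` large and `γ / n` near `θ`, because `γ` is a large multiple
of `α` plus a comparatively small remainder. -/
lemma eventually_root_le (h : IsSubmultiplicative C τ B) (hC : Convex ℝ C)
    (hnn : ∀ x ∈ C, ∀ i, 0 ≤ x i) {θ : Fin N → ℝ} (hθ : θ ∈ interior C) {a b : ℝ} (ha : 0 < a)
    (hab : a < b)
    (hfreq : ∃ᶠ x in directionFilter C θ, τ x.1 x.2 ^ (1 / (x.1 : ℝ)) < a) :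
    ∀ᶠ x in directionFilter C θ, τ x.1 x.2 ^ (1 / (x.1 : ℝ)) ≤ b := by
  obtain ⟨ρ, hρ, hball⟩ := Metric.mem_nhds_iff.1 (mem_interior_iff_mem_nhds.1 hθ)
  have hB0 : 0 < B := zero_lt_one.trans_le h.one_le
  set Q : ℝ := max 1 (B / a) with hQ
  have hQ1 : 1 ≤ Q := le_max_left _ _
  have hQ0 : 0 < Q := zero_lt_one.trans_le hQ1
  -- the relative size `ε` of the remainder is chosen so that its contribution is below `b / a`
  obtain ⟨ε, hεb, hε0, hε1⟩ : ∃ ε : ℝ, a * Q ^ (2 * ε) < b ∧ 0 < ε ∧ ε < 1 := by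
    have hcont : ContinuousAt (fun ε : ℝ => a * Q ^ (2 * ε)) 0 :=
      continuousAt_const.mul
        ((Real.continuous_const_rpow hQ0.ne').comp
          (continuous_const.mul continuous_id)).continuousAt
    have h1 : ∀ᶠ ε in 𝓝[>] (0 : ℝ), a * Q ^ (2 * ε) < b :=
      (hcont.eventually (gt_mem_nhds (by simpa using hab))).filter_mono nhdsWithin_le_nhds
    have h2 : ∀ᶠ ε in 𝓝[>] (0 : ℝ), 0 < ε ∧ ε < 1 := Ioo_mem_nhdsGT one_pos
    exact (h1.and h2).exists
  have hδ : 0 < ε * ρ / 2 := by positivity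
  obtain ⟨⟨k, α⟩, hka, hk0, hkα, hkd⟩ : ∃ x : ℕ × (Fin N →₀ ℕ),
      τ x.1 x.2 ^ (1 / (x.1 : ℝ)) < a ∧ 0 < x.1 ∧ x.2 ∈ latticePoints C x.1 ∧
        ‖expVec x.2 - (x.1 : ℝ) • θ‖ < ε * ρ / 2 * x.1 :=
    (hfreq.and_eventually (eventually_directionFilter.2
      ⟨_, hδ, 0, fun n _ hn γ hγ hd => ⟨hn, hγ, hd⟩⟩)).exists
  dsimp only at hka hk0 hkα hkd
  have hk0' : (0 : ℝ) < k := Nat.cast_pos.2 hk0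
  have hτa : τ k α ≤ a ^ k := (root_le_iff (h.nonneg k α) ha.le hk0).1 hka.le
  refine eventually_directionFilter.2 ⟨_, hδ, ⌈(k : ℝ) / ε⌉₊, fun n hn hn0 γ hγ hd => ?_⟩
  have hn0' : (0 : ℝ) < n := Nat.cast_pos.2 hn0
  have hkn : (k : ℝ) ≤ ε * n := by
    rw [mul_comm, ← div_le_iff₀ hε0]
    exact Nat.ceil_le.1 hn
  set q : ℕ := ⌊(1 - ε) * n / k⌋₊ with hq
  have hq1 : (q : ℝ) * k ≤ (1 - ε) * n := by
    rw [← le_div_iff₀ hk0']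
    exact Nat.floor_le (by have := sub_nonneg.2 hε1.le; positivity)
  have hq2 : (1 - ε) * n < (q + 1) * k := by
    rw [← div_lt_iff₀ hk0']
    exact Nat.lt_floor_add_one _
  have hqn : q * k ≤ n := by
    have : ((q * k : ℕ) : ℝ) ≤ n := by push_cast; nlinarith
    exact_mod_cast this
  obtain ⟨m, hndef⟩ := Nat.exists_eq_add_of_le hqn
  have hm : (m : ℝ) = n - q * k := by rw [hndef]; push_cast; ring
  have hm1 : ε * n ≤ m := by rw [hm]; linarith
  have hm2 : (m : ℝ) ≤ 2 * ε * n := by rw [hm]; linarith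
  have hm0 : 0 < m := by
    have : (0 : ℝ) < m := (mul_pos hε0 hn0').trans_le hm1
    exact_mod_cast this
  obtain ⟨β, hβ, hγβ⟩ : ∃ β ∈ latticePoints C m, γ = q • α + β := by
    refine exists_eq_nsmul_add hnn hball (k := k) hm0 ?_
    rw [← hndef]
    have h1 : (q : ℝ) * ‖expVec α - (k : ℝ) • θ‖ ≤ ε * ρ / 2 * n := by
      calc (q : ℝ) * ‖expVec α - (k : ℝ) • θ‖ ≤ q * (ε * ρ / 2 * k) := by gcongr
        _ = ε * ρ / 2 * (q * k) := by ring
        _ ≤ ε * ρ / 2 * n := by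
          refine mul_le_mul_of_nonneg_left ?_ hδ.le
          exact_mod_cast hqn
    nlinarith [mul_le_mul_of_nonneg_left hm1 hρ.le]
  rw [root_le_iff (h.nonneg _ _) (ha.trans hab).le hn0]
  calc τ n γ ≤ τ k α ^ q * τ m β := by
        rw [hγβ, hndef]
        exact (h.nsmul_add_le hC hkα hβ q).2
    _ ≤ (a ^ k) ^ q * B ^ m :=
        mul_le_mul (pow_le_pow_left₀ (h.nonneg _ _) hτa q) (h.le_pow m β hβ) (h.nonneg _ _)
          (by positivity)
    _ = a ^ n * (B / a) ^ m := by
        rw [hndef, ← pow_mul, mul_comm k q, pow_add, mul_assoc, ← mul_pow,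
          mul_div_cancel₀ B ha.ne']
    _ ≤ a ^ n * Q ^ m := by
        gcongr
        exact le_max_right _ _
    _ = a ^ n * Q ^ (m : ℝ) := by rw [Real.rpow_natCast]
    _ ≤ a ^ n * Q ^ (2 * ε * n) := by gcongr
    _ = (a * Q ^ (2 * ε)) ^ n := by
        rw [mul_pow, Real.rpow_mul hQ0.le, Real.rpow_natCast]
    _ ≤ b ^ n := by gcongr

lemma exists_tendsto (h : IsSubmultiplicative C τ B) (hC : Convex ℝ C)
    (hnn : ∀ x ∈ C, ∀ i, 0 ≤ x i) {θ : Fin N → ℝ} (hθ : θ ∈ interior C) :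
    ∃ t, Tendsto (fun x : ℕ × (Fin N →₀ ℕ) => τ x.1 x.2 ^ (1 / (x.1 : ℝ)))
      (directionFilter C θ) (𝓝 t) := by
  refine tendsto_of_no_upcrossings dense_univ ?_ ?_ ?_
  · rintro a - b - hab ⟨hfa, hfb⟩
    obtain ⟨x, hx⟩ := hfa.exists
    have ha : 0 < a := (Real.rpow_nonneg (h.nonneg _ _) _).trans_lt hx
    have := h.eventually_root_le hC hnn hθ ha hab hfa
    exact hfb (this.mono fun x hx => not_lt.2 hx)
  · exact isBoundedUnder_of_eventually_le (a := B) (eventually_directionFilter.2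
      ⟨1, one_pos, 0, fun n _ hn γ hγ _ => h.root_le hn hγ⟩)
  · exact isBoundedUnder_of_eventually_ge (a := 0)
      (Eventually.of_forall fun x => Real.rpow_nonneg (h.nonneg _ _) _)

/-- If the limit is positive in one interior direction `θ`, then the roots are bounded below on all
of `kC`, boundary exponents included: every `α ∈ kC` can be completed by an exponent `β ∈ RkC` to an
exponent in a direction close to `θ`. -/
lemma exists_pos_le_root (h : IsSubmultiplicative C τ B) (hcpt : IsCompact C)
    (hC : Convex ℝ C) (hnn : ∀ x ∈ C, ∀ i, 0 ≤ x i) {θ : Fin N → ℝ} (hθ : θ ∈ interior C) {t : ℝ}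
    (ht : 0 < t) (hlim : Tendsto (fun x : ℕ × (Fin N →₀ ℕ) => τ x.1 x.2 ^ (1 / (x.1 : ℝ)))
      (directionFilter C θ) (𝓝 t)) :
    ∃ c : ℝ, 0 < c ∧ ∀ k, 0 < k → ∀ α ∈ latticePoints C k, c ≤ τ k α ^ (1 / (k : ℝ)) := by
  obtain ⟨ρ, hρ, hball⟩ := Metric.mem_nhds_iff.1 (mem_interior_iff_mem_nhds.1 hθ)
  have hB0 : 0 < B := zero_lt_one.trans_le h.one_le
  have hθ0 := hnn θ (interior_subset hθ)
  obtain ⟨δ, hδ, n₀, hn₀⟩ := eventually_directionFilter.1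
    (hlim.eventually (lt_mem_nhds (half_lt_self ht)))
  obtain ⟨d, hd⟩ := hcpt.exists_bound_of_continuousOn (f := fun x : Fin N → ℝ => x - θ)
    (by fun_prop)
  have hd0 : 0 ≤ d := (norm_nonneg _).trans (hd θ (interior_subset hθ))
  -- `R` is large enough for all `k ≥ 1` at once: `(R + 1)k ≥ n₀`, and the displacement of
  -- `(R + 1)kθ - α` from `Rkθ`, at most `kd` plus a rounding error `1`, is below `ρRk`
  obtain ⟨R, hR⟩ := exists_nat_gt (max ((1 + d) / ρ) (max (1 / δ) n₀))
  obtain ⟨hR1, hR2, hR3⟩ : 1 + d < ρ * R ∧ 1 < δ * R ∧ n₀ < R := by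
    rw [max_lt_iff, max_lt_iff, div_lt_iff₀ hρ, div_lt_iff₀ hδ, Nat.cast_lt] at hR
    exact ⟨by linarith [hR.1], by linarith [hR.2.1], hR.2.2⟩
  refine ⟨(t / 2) ^ (R + 1) / B ^ R, by positivity, fun k hk α hα => ?_⟩
  have hk1 : (1 : ℝ) ≤ k := Nat.one_le_cast.2 hk
  set m := R * k with hm
  set n := 1 * k + m with hn
  have hRpos : 0 < R := by omega
  have hRm : R ≤ m := Nat.le_mul_of_pos_right R hk
  have hm0 : 0 < m := Nat.mul_pos hRpos hk
  have hn0 : 0 < n := by omega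
  have hRn : (R : ℝ) ≤ n := Nat.cast_le.2 (by omega)
  have hdist : ‖expVec α - (k : ℝ) • θ‖ ≤ k * d := by
    obtain ⟨x, hx, hxα⟩ := hα
    change (k : ℝ) • x = _ at hxα
    rw [← hxα, ← smul_sub, norm_smul, Real.norm_of_nonneg k.cast_nonneg]
    exact mul_le_mul_of_nonneg_left (hd x hx) k.cast_nonneg
  have hfl := norm_floorVec_sub_le hθ0 n
  set γ := floorVec n θ with hγ
  have hγn : γ ∈ latticePoints C n := by
    refine mem_latticePoints_of_norm_lt hball hn0 (hfl.trans_lt ?_)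
    nlinarith
  obtain ⟨β, hβ, hγβ⟩ : ∃ β ∈ latticePoints C m, γ = 1 • α + β := by
    refine exists_eq_nsmul_add hnn hball (k := k) hm0 ?_
    rw [← hn, Nat.cast_one, one_mul, hm, Nat.cast_mul]
    nlinarith
  have hlow : (t / 2) ^ n ≤ τ n γ := by
    refine (le_root_iff (h.nonneg _ _) (by positivity) hn0).1
      (hn₀ n (by omega) hn0 γ hγn (hfl.trans_lt ?_)).le
    nlinarith
  have hup : τ n γ ≤ τ k α * B ^ m := by
    rw [hγβ]
    refine (h.nsmul_add_le hC hα hβ 1).2.trans ?_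
    rw [pow_one]
    exact mul_le_mul_of_nonneg_left (h.le_pow m β hβ) (h.nonneg _ _)
  rw [le_root_iff (h.nonneg _ _) (by positivity) hk, div_pow, ← pow_mul, ← pow_mul,
    div_le_iff₀ (by positivity)]
  have hn' : (R + 1) * k = n := by rw [hn, hm]; ring
  rw [hn']
  exact hlow.trans hup

end IsSubmultiplicative

/-! ### Riemann sums over the lattice points of `kC` -/

/-- The half-open cube of side `1 / k` with lowest corner `α / k`. -/
def cell (k : ℕ) (α : Fin N →₀ ℕ) : Set (Fin N → ℝ) :=
  Set.univ.pi fun i => Set.Ico ((α i : ℝ) / k) ((α i + 1 : ℝ) / k)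

lemma mem_cell_iff {k : ℕ} (hk : 0 < k) {α : Fin N →₀ ℕ} {θ : Fin N → ℝ} :
    θ ∈ cell k α ↔ (∀ i, 0 ≤ θ i) ∧ floorVec k θ = α := by
  have hk' : (0 : ℝ) < k := Nat.cast_pos.2 hk
  have hcell : θ ∈ cell k α ↔ ∀ i, (α i : ℝ) ≤ k * θ i ∧ (k : ℝ) * θ i < α i + 1 := by
    simp only [cell, Set.mem_univ_pi, Set.mem_Ico, div_le_iff₀ hk', lt_div_iff₀ hk', mul_comm]
  rw [hcell, Finsupp.ext_iff, ← forall_and]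
  refine forall_congr' fun i => ?_
  rw [floorVec_apply]
  constructor
  · rintro ⟨h1, h2⟩
    have h0 : 0 ≤ (k : ℝ) * θ i := (Nat.cast_nonneg _).trans h1
    exact ⟨nonneg_of_mul_nonneg_right h0 hk', (Nat.floor_eq_iff h0).2 ⟨h1, h2⟩⟩
  · rintro ⟨h0, h1⟩
    exact (Nat.floor_eq_iff (mul_nonneg hk'.le h0)).1 h1

lemma measurableSet_cell (k : ℕ) (α : Fin N →₀ ℕ) : MeasurableSet (cell k α) :=
  MeasurableSet.univ_pi fun _ => measurableSet_Ico

lemma volume_cell (k : ℕ) (α : Fin N →₀ ℕ) :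
    volume (cell k α) = ENNReal.ofReal (((k : ℝ) ^ N)⁻¹) := by
  rw [cell, Real.volume_pi_Ico]
  have h : ∀ i, ((α i + 1 : ℝ) / k - (α i : ℝ) / k) = (k : ℝ)⁻¹ := fun i => by ring
  simp only [h, Finset.prod_const, Finset.card_univ, Fintype.card_fin]
  rw [← ENNReal.ofReal_pow (by positivity), inv_pow]

/-- The step function with value `h α` on the cube of each `α ∈ kC ∩ ℤ^N`, and `0` elsewhere. -/
noncomputable def stepFun {C : Set (Fin N → ℝ)} (hC : IsCompact C) (k : ℕ)
    (h : (Fin N →₀ ℕ) → ℝ) (θ : Fin N → ℝ) : ℝ :=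
  ∑ α ∈ (finite_latticePoints hC k).toFinset, (cell k α).indicator (fun _ => h α) θ

section Riemann

variable {C : Set (Fin N → ℝ)} (hC : IsCompact C)

include hC

lemma measurable_stepFun (k : ℕ) (h : (Fin N →₀ ℕ) → ℝ) : Measurable (stepFun hC k h) :=
  Finset.measurable_sum _ fun α _ => measurable_const.indicator (measurableSet_cell k α)

lemma integral_stepFun (k : ℕ) (h : (Fin N →₀ ℕ) → ℝ) :
    ∫ θ, stepFun hC k h θ =
      ((k : ℝ) ^ N)⁻¹ * ∑ α ∈ (finite_latticePoints hC k).toFinset, h α := by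
  unfold stepFun
  rw [integral_finsetSum, Finset.mul_sum]
  · refine Finset.sum_congr rfl fun α _ => ?_
    rw [integral_indicator_const _ (measurableSet_cell k α), measureReal_def, volume_cell,
      ENNReal.toReal_ofReal (by positivity), smul_eq_mul]
  · intro α _
    refine (integrable_indicator_iff (measurableSet_cell k α)).2 (integrableOn_const ?_)
    rw [volume_cell]
    exact ENNReal.ofReal_ne_top

lemma stepFun_eq_of_mem {k : ℕ} (hk : 0 < k) (h : (Fin N →₀ ℕ) → ℝ) {α : Fin N →₀ ℕ}
    (hα : α ∈ latticePoints C k) {θ : Fin N → ℝ} (hθ : θ ∈ cell k α) :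
    stepFun hC k h θ = h α := by
  unfold stepFun
  rw [Finset.sum_eq_single α, Set.indicator_of_mem hθ]
  · intro β _ hne
    refine Set.indicator_of_notMem (fun hβ => hne ?_) _
    exact ((mem_cell_iff hk).1 hβ).2.symm.trans ((mem_cell_iff hk).1 hθ).2
  · intro hn
    exact absurd ((Set.Finite.mem_toFinset _).2 hα) hn

lemma stepFun_eq_zero_or {k : ℕ} (hk : 0 < k) (h : (Fin N →₀ ℕ) → ℝ) (θ : Fin N → ℝ) :
    stepFun hC k h θ = 0 ∨ ∃ α ∈ latticePoints C k, stepFun hC k h θ = h α ∧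
      ∃ x ∈ C, dist θ x ≤ (k : ℝ)⁻¹ := by
  by_cases hex : ∃ α ∈ latticePoints C k, θ ∈ cell k α
  · obtain ⟨α, hα, hθ⟩ := hex
    refine Or.inr ⟨α, hα, stepFun_eq_of_mem hC hk h hα hθ, ?_⟩
    obtain ⟨x, hx, hxα⟩ := hα
    change (k : ℝ) • x = _ at hxα
    obtain ⟨hθ0, rfl⟩ := (mem_cell_iff hk).1 hθ
    have hk' : (0 : ℝ) < k := Nat.cast_pos.2 hk
    have hd := norm_floorVec_sub_le hθ0 k
    rw [← hxα, ← smul_sub, norm_smul, Real.norm_of_nonneg hk'.le] at hd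
    refine ⟨x, hx, ?_⟩
    rw [dist_comm, dist_eq_norm]
    rwa [← one_div, le_div_iff₀' hk']
  · left
    push Not at hex
    exact Finset.sum_eq_zero fun α hα => Set.indicator_of_notMem
      (hex α ((Set.Finite.mem_toFinset _).1 hα)) _

lemma tendsto_stepFun (hnn : ∀ x ∈ C, ∀ i, 0 ≤ x i) {h : ℕ → (Fin N →₀ ℕ) → ℝ}
    {g : (Fin N → ℝ) → ℝ}
    (hlim : ∀ θ ∈ interior C, Tendsto (fun x : ℕ × (Fin N →₀ ℕ) => h x.1 x.2)
      (directionFilter C θ) (𝓝 (g θ))) {θ : Fin N → ℝ} (hθ : θ ∉ frontier C) :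
    Tendsto (fun k => stepFun hC k (h k) θ) atTop (𝓝 ((interior C).indicator g θ)) := by
  by_cases hθi : θ ∈ interior C
  · rw [Set.indicator_of_mem hθi]
    have hfl := tendsto_floorVec hnn hθi
    refine ((hlim θ hθi).comp hfl).congr' ?_
    have hmem := hfl.eventually
      (eventually_directionFilter (P := fun x => x.2 ∈ latticePoints C x.1) |>.2
        ⟨1, one_pos, 0, fun n _ _ γ hγ _ => hγ⟩)
    filter_upwards [hmem, eventually_gt_atTop 0] with k hk hk0
    exact (stepFun_eq_of_mem hC hk0 (h k) hk
      ((mem_cell_iff hk0).2 ⟨hnn θ (interior_subset hθi), rfl⟩)).symm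
  · rw [Set.indicator_of_notMem hθi]
    have hθc : θ ∉ C := fun hθC => hθ ⟨subset_closure hθC, hθi⟩
    obtain ⟨δ, hδ, hball⟩ := Metric.isOpen_iff.1 hC.isClosed.isOpen_compl θ hθc
    refine tendsto_const_nhds.congr' ?_
    have hsmall : ∀ᶠ k : ℕ in atTop, (k : ℝ)⁻¹ < δ :=
      tendsto_inv_atTop_nhds_zero_nat.eventually (gt_mem_nhds hδ)
    filter_upwards [hsmall, eventually_gt_atTop 0] with k hk hk0
    rcases stepFun_eq_zero_or hC hk0 (h k) θ with h0 | ⟨α, -, -, x, hx, hd⟩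
    · exact h0.symm
    · exact absurd hx (hball (Metric.mem_ball.2 ((dist_comm x θ).trans_lt (hd.trans_lt hk))))

lemma ae_tendsto_stepFun (hconv : Convex ℝ C) (hnn : ∀ x ∈ C, ∀ i, 0 ≤ x i)
    {h : ℕ → (Fin N →₀ ℕ) → ℝ} {g : (Fin N → ℝ) → ℝ}
    (hlim : ∀ θ ∈ interior C, Tendsto (fun x : ℕ × (Fin N →₀ ℕ) => h x.1 x.2)
      (directionFilter C θ) (𝓝 (g θ))) :
    ∀ᵐ θ, Tendsto (fun k => stepFun hC k (h k) θ) atTop (𝓝 ((interior C).indicator g θ)) := by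
  filter_upwards [measure_eq_zero_iff_ae_notMem.1 (hconv.addHaar_frontier volume)] with θ hθ
  exact tendsto_stepFun hC hnn hlim hθ

lemma aemeasurable_of_tendsto_directionFilter (hconv : Convex ℝ C) (hnn : ∀ x ∈ C, ∀ i, 0 ≤ x i)
    {h : ℕ → (Fin N →₀ ℕ) → ℝ} {g : (Fin N → ℝ) → ℝ}
    (hlim : ∀ θ ∈ interior C, Tendsto (fun x : ℕ × (Fin N →₀ ℕ) => h x.1 x.2)
      (directionFilter C θ) (𝓝 (g θ))) :
    AEMeasurable g (volume.restrict (interior C)) := by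
  rw [← aemeasurable_indicator_iff isOpen_interior.measurableSet]
  exact aemeasurable_of_tendsto_metrizable_ae atTop
    (fun k => (measurable_stepFun hC k (h k)).aemeasurable)
    (ae_tendsto_stepFun hC hconv hnn hlim)

/-- Normalized lattice sums over `kC` of uniformly bounded functions with directional limits `g`
converge to the integral of `g`. -/
lemma tendsto_latticeSum (hconv : Convex ℝ C) (hnn : ∀ x ∈ C, ∀ i, 0 ≤ x i)
    {h : ℕ → (Fin N →₀ ℕ) → ℝ} {g : (Fin N → ℝ) → ℝ} {b : ℝ}
    (hb : ∀ k, 0 < k → ∀ α ∈ latticePoints C k, |h k α| ≤ b)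
    (hlim : ∀ θ ∈ interior C, Tendsto (fun x : ℕ × (Fin N →₀ ℕ) => h x.1 x.2)
      (directionFilter C θ) (𝓝 (g θ))) :
    Tendsto (fun k : ℕ => ((k : ℝ) ^ N)⁻¹ *
        ∑ α ∈ (finite_latticePoints hC k).toFinset, h k α) atTop
      (𝓝 (∫ θ in interior C, g θ)) := by
  simp_rw [← integral_stepFun hC]
  rw [← integral_indicator isOpen_interior.measurableSet]
  have hT : IsCompact (Metric.cthickening 1 C) := hC.cthickening
  refine tendsto_integral_filter_of_dominated_convergence
    ((Metric.cthickening 1 C).indicator fun _ => |b|)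
    (Eventually.of_forall fun k => (measurable_stepFun hC k (h k)).aestronglyMeasurable) ?_
    ((integrable_indicator_iff hT.measurableSet).2 (integrableOn_const hT.measure_lt_top.ne))
    (ae_tendsto_stepFun hC hconv hnn hlim)
  filter_upwards [eventually_gt_atTop 0] with k hk
  refine Eventually.of_forall fun θ => ?_
  rcases stepFun_eq_zero_or hC hk (h k) θ with h0 | ⟨α, hα, h1, x, hx, hd⟩
  · rw [h0, norm_zero]
    exact Set.indicator_nonneg (fun _ _ => abs_nonneg b) θ
  · have hk1 : (k : ℝ)⁻¹ ≤ 1 := inv_le_one_of_one_le₀ (Nat.one_le_cast.2 hk)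
    rw [Set.indicator_of_mem (Metric.mem_cthickening_of_dist_le θ x 1 C hx (hd.trans hk1)), h1]
    exact (hb k hk α hα).trans (le_abs_self b)

end Riemann

/-! ### Volume of `C` and asymptotic counts of lattice points -/

lemma volume_open_simplex_pos (N : ℕ) :
    0 < volume {x : Fin N → ℝ | (∀ i, 0 < x i) ∧ ∑ i, x i < 1} := by
  refine IsOpen.measure_pos _ ?_ ⟨fun _ => (N + 1 : ℝ)⁻¹, fun _ => by positivity, ?_⟩
  · rw [Set.ofPred_and, Set.ofPred_forall]
    exact (isOpen_iInter_of_finite fun i => isOpen_lt continuous_const (continuous_apply i)).inter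
      (isOpen_lt (by fun_prop) continuous_const)
  · simp only [Finset.sum_const, Finset.card_univ, Fintype.card_fin, nsmul_eq_mul]
    rw [← div_eq_mul_inv, div_lt_one (by positivity)]
    linarith

lemma open_simplex_subset {C : Set (Fin N → ℝ)} (hs : simplex N ⊆ C) :
    {x : Fin N → ℝ | (∀ i, 0 < x i) ∧ ∑ i, x i < 1} ⊆ C :=
  fun _ hx => hs ⟨fun i => (hx.1 i).le, hx.2.le⟩

lemma vol_pos {C : Set (Fin N → ℝ)} (hC : IsCompact C) (hs : simplex N ⊆ C) : 0 < vol C :=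
  ENNReal.toReal_pos
    ((volume_open_simplex_pos N).trans_le (measure_mono (open_simplex_subset hs))).ne'
    hC.measure_lt_top.ne

lemma volume_interior {C : Set (Fin N → ℝ)} (hconv : Convex ℝ C) :
    volume (interior C) = volume C :=
  measure_congr (interior_ae_eq_of_null_frontier (hconv.addHaar_frontier volume))

lemma normConst_pos (hN : 0 < N) {C : Set (Fin N → ℝ)} (hC : IsCompact C)
    (hnn : ∀ x ∈ C, ∀ i, 0 ≤ x i) (hs : simplex N ⊆ C) : 0 < normConst C := by
  refine mul_pos (inv_pos.2 (vol_pos hC hs)) ?_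
  have hcont : Continuous fun θ : Fin N → ℝ => ∑ i, θ i := by fun_prop
  rw [setIntegral_pos_iff_support_of_nonneg_ae
    (ae_restrict_of_forall_mem hC.measurableSet fun θ hθ => Finset.sum_nonneg fun i _ => hnn θ hθ i)
    (hcont.continuousOn.integrableOn_compact hC)]
  refine (volume_open_simplex_pos N).trans_le (measure_mono fun x hx =>
    ⟨?_, open_simplex_subset hs hx⟩)
  exact (Finset.sum_pos (fun i _ => hx.1 i) ⟨⟨0, hN⟩, Finset.mem_univ _⟩).ne'

lemma card_latticePoints {C : Set (Fin N → ℝ)} (hC : IsCompact C) (k : ℕ) :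
    (finite_latticePoints hC k).toFinset.card = numPoints C k := by
  rw [numPoints, Nat.card_coe_set_eq, Set.ncard_eq_toFinset_card _ (finite_latticePoints hC k)]

lemma tendsto_numPoints_div {C : Set (Fin N → ℝ)} (hC : IsCompact C) (hconv : Convex ℝ C)
    (hnn : ∀ x ∈ C, ∀ i, 0 ≤ x i) :
    Tendsto (fun k : ℕ => ((k : ℝ) ^ N)⁻¹ * (numPoints C k : ℝ)) atTop (𝓝 (vol C)) := by
  have h := tendsto_latticeSum hC hconv hnn (h := fun _ _ => 1) (g := fun _ => 1) (b := 1)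
    (fun _ _ _ _ => by simp) (fun _ _ => tendsto_const_nhds)
  rw [setIntegral_const, measureReal_def, volume_interior hconv, smul_eq_mul, mul_one] at h
  refine h.congr fun k => ?_
  rw [Finset.sum_const, card_latticePoints hC, nsmul_one]

lemma tendsto_degreeSum_div {C : Set (Fin N → ℝ)} (hC : IsCompact C) (hconv : Convex ℝ C)
    (hnn : ∀ x ∈ C, ∀ i, 0 ≤ x i) :
    Tendsto (fun k : ℕ => ((k : ℝ) ^ N)⁻¹ * ((degreeSum C k : ℝ) / k)) atTop
      (𝓝 (∫ θ in C, ∑ i, θ i)) := by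
  have hcont : Continuous fun θ : Fin N → ℝ => ∑ i, θ i := by fun_prop
  obtain ⟨b, hb⟩ := hC.exists_bound_of_continuousOn hcont.continuousOn
  have h := tendsto_latticeSum hC hconv hnn
    (h := fun k α => ∑ i, ((k : ℝ)⁻¹ • expVec α) i) (g := fun θ => ∑ i, θ i) (b := b) ?_ ?_
  · rw [setIntegral_congr_set
      (interior_ae_eq_of_null_frontier (hconv.addHaar_frontier volume))] at h
    refine h.congr fun k => ?_
    rw [degreeSum, finsum_mem_eq_finite_toFinset_sum _ (finite_latticePoints hC k), Nat.cast_sum,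
      Finset.sum_div]
    congr 1
    refine Finset.sum_congr rfl fun α _ => ?_
    rw [Finsupp.degree_eq_sum, Nat.cast_sum, Finset.sum_div]
    refine Finset.sum_congr rfl fun i _ => ?_
    simp only [Pi.smul_apply, expVec, smul_eq_mul]
    ring
  · rintro k hk α ⟨x, hx, hxα⟩
    change (k : ℝ) • x = _ at hxα
    rw [← hxα, inv_smul_smul₀ (Nat.cast_ne_zero.2 hk.ne')]
    exact hb x hx
  · intro θ _
    refine (hcont.tendsto θ).comp (tendsto_comap.mono_left ?_)
    exact inf_le_left.trans inf_le_right

lemma tendsto_degreeSum_div_numPoints {C : Set (Fin N → ℝ)} (hC : IsCompact C)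
    (hconv : Convex ℝ C) (hnn : ∀ x ∈ C, ∀ i, 0 ≤ x i) (hs : simplex N ⊆ C) :
    Tendsto (fun k : ℕ => (degreeSum C k : ℝ) / (k * numPoints C k)) atTop (𝓝 (normConst C)) := by
  have h := (tendsto_degreeSum_div hC hconv hnn).div (tendsto_numPoints_div hC hconv hnn)
    (vol_pos hC hs).ne'
  rw [normConst, inv_mul_eq_div]
  refine h.congr' ?_
  filter_upwards [eventually_gt_atTop 0] with k hk
  have hk' : ((k : ℝ) ^ N)⁻¹ ≠ 0 := inv_ne_zero (pow_ne_zero _ (Nat.cast_ne_zero.2 hk.ne'))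
  simp only [Pi.div_apply]
  rw [mul_div_mul_left _ _ hk', div_div]

lemma eventually_numPoints_pos {C : Set (Fin N → ℝ)} (hC : IsCompact C) (hconv : Convex ℝ C)
    (hnn : ∀ x ∈ C, ∀ i, 0 ≤ x i) (hs : simplex N ⊆ C) : ∀ᶠ k in atTop, 0 < numPoints C k := by
  filter_upwards [(tendsto_numPoints_div hC hconv hnn).eventually (lt_mem_nhds (vol_pos hC hs))]
    with k hk
  rw [Nat.pos_iff_ne_zero]
  intro h0
  simp [h0] at hk

/-- `M_k!^{1/(k M_k)} → 1`, since `M_k!^{1/M_k} ≤ M_k` grows polynomially in `k`. -/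
lemma tendsto_factorial_root {C : Set (Fin N → ℝ)} (hC : IsCompact C) (hconv : Convex ℝ C)
    (hnn : ∀ x ∈ C, ∀ i, 0 ≤ x i) (hs : simplex N ⊆ C) :
    Tendsto (fun k : ℕ => ((numPoints C k).factorial : ℝ) ^ (1 / ((k : ℝ) * numPoints C k)))
      atTop (𝓝 1) := by
  have hinv : Tendsto (fun k : ℕ => 1 / (k : ℝ)) atTop (𝓝 0) :=
    tendsto_one_div_atTop_nhds_zero_nat
  have h1 := (tendsto_numPoints_div hC hconv hnn).rpow hinv (Or.inl (vol_pos hC hs).ne')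
  have h2 : Tendsto (fun k : ℕ => ((k : ℝ) ^ (1 / (k : ℝ))) ^ N) atTop (𝓝 (1 ^ N)) :=
    (tendsto_rpow_div.comp tendsto_natCast_atTop_atTop).pow N
  have hM : Tendsto (fun k : ℕ => (numPoints C k : ℝ) ^ (1 / (k : ℝ))) atTop (𝓝 1) := by
    have h3 := h1.mul h2
    rw [Real.rpow_zero, one_pow, one_mul] at h3
    refine h3.congr' ?_
    filter_upwards [eventually_gt_atTop 0] with k hk
    have hk' : (0 : ℝ) < k := Nat.cast_pos.2 hk
    rw [← Real.rpow_natCast (_ ^ _) N, ← Real.rpow_mul hk'.le, mul_comm _ (N : ℝ),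
      Real.rpow_mul hk'.le, Real.rpow_natCast, ← Real.mul_rpow (by positivity) (by positivity)]
    congr 1
    field_simp
  refine tendsto_of_tendsto_of_tendsto_of_le_of_le' tendsto_const_nhds hM ?_ ?_
  · refine Eventually.of_forall fun k => Real.one_le_rpow ?_ (by positivity)
    exact_mod_cast Nat.one_le_iff_ne_zero.2 (Nat.factorial_ne_zero _)
  · filter_upwards [eventually_gt_atTop 0, eventually_numPoints_pos hC hconv hnn hs] with k hk hM0
    have hM0' : (0 : ℝ) < numPoints C k := Nat.cast_pos.2 hM0
    have hk' : (0 : ℝ) < k := Nat.cast_pos.2 hk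
    calc ((numPoints C k).factorial : ℝ) ^ (1 / ((k : ℝ) * numPoints C k))
        ≤ ((numPoints C k : ℝ) ^ numPoints C k) ^ (1 / ((k : ℝ) * numPoints C k)) := by
          refine Real.rpow_le_rpow (by positivity) ?_ (by positivity)
          exact_mod_cast Nat.factorial_le_pow _
      _ = (numPoints C k : ℝ) ^ (1 / (k : ℝ)) := by
          rw [← Real.rpow_natCast, ← Real.rpow_mul hM0'.le]
          congr 1
          field_simp

/-! ### Geometric means and the transfinite diameter -/

lemma prod_pow_rpow_eq_exp {ι : Type*} (S : Finset ι) {t : ι → ℝ} (ht : ∀ i ∈ S, 0 < t i) {k : ℕ}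
    (hk : 0 < k) (hS : 0 < S.card) :
    (∏ i ∈ S, t i ^ k) ^ (1 / ((k : ℝ) * S.card)) =
      Real.exp ((S.card : ℝ)⁻¹ * ∑ i ∈ S, Real.log (t i)) := by
  have hk' : (k : ℝ) ≠ 0 := Nat.cast_ne_zero.2 hk.ne'
  have hS' : (S.card : ℝ) ≠ 0 := Nat.cast_ne_zero.2 hS.ne'
  have h : ∏ i ∈ S, t i ^ k = Real.exp (k * ∑ i ∈ S, Real.log (t i)) := by
    rw [Finset.mul_sum, Real.exp_sum]
    refine Finset.prod_congr rfl fun i hi => ?_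
    rw [Real.exp_nat_mul, Real.exp_log (ht i hi)]
  rw [h, ← Real.exp_mul]
  congr 1
  field_simp

lemma tendsto_geometricMean {C : Set (Fin N → ℝ)} (hC : IsCompact C) (hconv : Convex ℝ C)
    (hnn : ∀ x ∈ C, ∀ i, 0 ≤ x i) (hs : simplex N ⊆ C) {t : ℕ → (Fin N →₀ ℕ) → ℝ} {c B : ℝ}
    (hc : 0 < c) (ht : ∀ k, 0 < k → ∀ α ∈ latticePoints C k, c ≤ t k α ∧ t k α ≤ B)
    {g : (Fin N → ℝ) → ℝ}
    (hlim : ∀ θ ∈ interior C, Tendsto (fun x : ℕ × (Fin N →₀ ℕ) => t x.1 x.2)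
      (directionFilter C θ) (𝓝 (g θ))) (hg : ∀ θ ∈ interior C, g θ ≠ 0) :
    Tendsto (fun k : ℕ => (∏ α ∈ (finite_latticePoints hC k).toFinset, t k α ^ k) ^
        (1 / ((k : ℝ) * numPoints C k))) atTop
      (𝓝 (Real.exp ((vol C)⁻¹ * ∫ θ in interior C, Real.log (g θ)))) := by
  have hsum := tendsto_latticeSum hC hconv hnn (h := fun k α => Real.log (t k α))
    (g := fun θ => Real.log (g θ)) (b := max |Real.log c| |Real.log B|)
    (fun k hk α hα => abs_le_max_abs_abs (Real.log_le_log hc (ht k hk α hα).1)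
      (Real.log_le_log (hc.trans_le (ht k hk α hα).1) (ht k hk α hα).2))
    (fun θ hθ => (hlim θ hθ).log (hg θ hθ))
  have h := ((tendsto_numPoints_div hC hconv hnn).inv₀ (vol_pos hC hs).ne').mul hsum
  refine ((Real.continuous_exp.tendsto _).comp h).congr' ?_
  filter_upwards [eventually_gt_atTop 0, eventually_numPoints_pos hC hconv hnn hs] with k hk hM
  have hk' : (k : ℝ) ≠ 0 := Nat.cast_ne_zero.2 hk.ne'
  simp only [Function.comp_apply]
  rw [← card_latticePoints hC k] at hM ⊢
  rw [prod_pow_rpow_eq_exp _ (fun α hα => hc.trans_le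
    (ht k hk α ((Set.Finite.mem_toFinset _).1 hα)).1) hk hM]
  congr 1
  field_simp

lemma erealIntegral_eq_coe {X : Type*} [MeasurableSpace X] {μ : Measure X} {F : X → EReal}
    {f : X → ℝ} (hf : Integrable f μ) (hF : ∀ᵐ x ∂μ, F x = (f x : EReal)) :
    erealIntegral F μ = ((∫ x, f x ∂μ : ℝ) : EReal) := by
  have h1 : ∫⁻ x, (F x).toENNReal ∂μ = ∫⁻ x, ENNReal.ofReal (f x) ∂μ :=
    lintegral_congr_ae (hF.mono fun x hx => by simp only [hx, EReal.real_coe_toENNReal])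
  have h2 : ∫⁻ x, (-F x).toENNReal ∂μ = ∫⁻ x, ENNReal.ofReal (-f x) ∂μ :=
    lintegral_congr_ae (hF.mono fun x hx => by
      simp only [hx, ← EReal.coe_neg, EReal.real_coe_toENNReal])
  have h3 : ∫⁻ x, ENNReal.ofReal (-f x) ∂μ ≠ ⊤ := hf.neg.lintegral_lt_top.ne
  rw [erealIntegral, h1, h2, integral_eq_lintegral_pos_part_sub_lintegral_neg_part hf,
    EReal.coe_sub, EReal.coe_ennreal_toReal hf.lintegral_lt_top.ne,
    EReal.coe_ennreal_toReal h3]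

lemma erealIntegral_eq_bot {X : Type*} [MeasurableSpace X] {μ : Measure X} (hμ : μ ≠ 0)
    {F : X → EReal} (hF : ∀ᵐ x ∂μ, F x = ⊥) : erealIntegral F μ = ⊥ := by
  have h1 : ∫⁻ x, (F x).toENNReal ∂μ = 0 := by
    rw [lintegral_congr_ae (hF.mono fun x hx => by rw [hx, EReal.toENNReal_bot]), lintegral_zero]
  have h2 : ∫⁻ x, (-F x).toENNReal ∂μ = ⊤ := by
    rw [lintegral_congr_ae (hF.mono fun x hx => by rw [hx, EReal.neg_bot, EReal.toENNReal_top]),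
      lintegral_const, ENNReal.top_mul (Measure.measure_univ_ne_zero.2 hμ)]
  rw [erealIntegral, h1, h2]
  rfl

section Diameter

variable {C : Set (Fin N → ℝ)} {K : Set (Fin N → ℂ)} {w : (Fin N → ℂ) → ℝ} {B : ℝ}

lemma discreteCheb_pow (hw : ∀ z ∈ K, 0 ≤ w z) {k : ℕ} (hk : 0 < k) (α : Fin N →₀ ℕ) :
    discreteCheb C K w k α ^ k = minNorm C K w k α :=
  root_pow (minNorm_nonneg hw k α) hk

lemma discreteCheb_nonneg (hw : ∀ z ∈ K, 0 ≤ w z) (k : ℕ) (α : Fin N →₀ ℕ) :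
    0 ≤ discreteCheb C K w k α :=
  Real.rpow_nonneg (minNorm_nonneg hw k α) _

lemma tendsto_directionalCheb (hτ : IsSubmultiplicative C (minNorm C K w) B)
    (hconv : Convex ℝ C) (hnn : ∀ x ∈ C, ∀ i, 0 ≤ x i) {θ : Fin N → ℝ} (hθ : θ ∈ interior C) :
    Tendsto (fun x : ℕ × (Fin N →₀ ℕ) => discreteCheb C K w x.1 x.2)
      (directionFilter C θ) (𝓝 (directionalCheb C K w θ)) :=
  tendsto_nhds_limUnder (hτ.exists_tendsto hconv hnn hθ)

lemma directionalCheb_mem_Icc (hτ : IsSubmultiplicative C (minNorm C K w) B)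
    (hconv : Convex ℝ C) (hnn : ∀ x ∈ C, ∀ i, 0 ≤ x i) {θ : Fin N → ℝ} (hθ : θ ∈ interior C)
    {c : ℝ} (hc : ∀ k, 0 < k → ∀ α ∈ latticePoints C k, c ≤ discreteCheb C K w k α) :
    directionalCheb C K w θ ∈ Set.Icc c B := by
  have := directionFilter_neBot hnn hθ
  refine isClosed_Icc.mem_of_tendsto (tendsto_directionalCheb hτ hconv hnn hθ)
    (eventually_directionFilter.2 ⟨1, one_pos, 0, fun n _ hn γ hγ _ => ?_⟩)
  exact ⟨hc n hn γ hγ, hτ.root_le hn hγ⟩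

/-- Either the discrete Chebyshev constants are bounded away from zero, or the directional constants
vanish identically; in both cases the Vandermonde roots converge to the exponential of the mean of
the Chebyshev transform. -/
lemma exists_tendsto_fullVandermonde (hC : IsCompact C) (hconv : Convex ℝ C)
    (hnn : ∀ x ∈ C, ∀ i, 0 ≤ x i) (hs : simplex N ⊆ C) (hK : IsCompact K)
    (hw : ∀ z ∈ K, 0 ≤ w z) (hb : BddAbove (w '' K))
    (hτ : IsSubmultiplicative C (minNorm C K w) B)
    (e : ∀ k, Fin (numPoints C k) ≃ latticePoints C k) :
    ∃ D : ℝ, 0 ≤ D ∧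
      Tendsto (fun k : ℕ => fullVandermonde C K w k (e k) ^ (1 / ((k : ℝ) * (numPoints C k : ℝ))))
        atTop (𝓝 D) ∧
      ENNReal.ofReal D = EReal.exp ((((vol C)⁻¹ : ℝ) : EReal) *
        erealIntegral (chebTransform C K w) (volume.restrict (interior C))) := by
  have hlim := fun θ hθ => tendsto_directionalCheb (θ := θ) hτ hconv hnn hθ
  have hvol := vol_pos hC hs
  have hfac := tendsto_factorial_root hC hconv hnn hs
  have hP0 : ∀ k, 0 ≤ ∏ α ∈ (finite_latticePoints hC k).toFinset, minNorm C K w k α :=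
    fun k => Finset.prod_nonneg fun α _ => minNorm_nonneg hw k α
  have hV0 : ∀ k, 0 ≤ fullVandermonde C K w k (e k) := fun k => maxVandermonde_nonneg k _
  by_cases hpos : ∃ θ ∈ interior C, 0 < directionalCheb C K w θ
  · obtain ⟨θ₀, hθ₀, ht⟩ := hpos
    obtain ⟨c, hc, hcle⟩ : ∃ c : ℝ, 0 < c ∧ ∀ k, 0 < k → ∀ α ∈ latticePoints C k,
        c ≤ discreteCheb C K w k α :=
      hτ.exists_pos_le_root hC hconv hnn hθ₀ ht (hlim θ₀ hθ₀)
    have hIcc := fun θ hθ => directionalCheb_mem_Icc (θ := θ) hτ hconv hnn hθ hcle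
    have hgpos : ∀ θ ∈ interior C, 0 < directionalCheb C K w θ :=
      fun θ hθ => hc.trans_le (hIcc θ hθ).1
    have hgm := tendsto_geometricMean hC hconv hnn hs hc
      (fun k hk α hα => ⟨hcle k hk α hα, hτ.root_le hk hα⟩) hlim (fun θ hθ => (hgpos θ hθ).ne')
    have hgm' : Tendsto (fun k : ℕ =>
        (∏ α ∈ (finite_latticePoints hC k).toFinset, minNorm C K w k α) ^
          (1 / ((k : ℝ) * numPoints C k))) atTop
        (𝓝 (Real.exp ((vol C)⁻¹ * ∫ θ in interior C, Real.log (directionalCheb C K w θ)))) := by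
      refine hgm.congr' ?_
      filter_upwards [eventually_gt_atTop 0] with k hk
      rw [Finset.prod_congr rfl fun α _ => discreteCheb_pow hw hk α]
    have hup := hfac.mul hgm'
    rw [one_mul] at hup
    refine ⟨_, (Real.exp_pos _).le, tendsto_of_tendsto_of_tendsto_of_le_of_le hgm' hup
      (fun k => ?_) (fun k => ?_), ?_⟩
    · exact Real.rpow_le_rpow (hP0 k) (prod_le_fullVandermonde_le hC hK hw hb k (e k)).1
        (by positivity)
    · dsimp only
      rw [← Real.mul_rpow (Nat.cast_nonneg _) (hP0 k)]
      exact Real.rpow_le_rpow (hV0 k) (prod_le_fullVandermonde_le hC hK hw hb k (e k)).2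
        (by positivity)
    · have hint : Integrable (fun θ => Real.log (directionalCheb C K w θ))
          (volume.restrict (interior C)) := by
        have : IsFiniteMeasure (volume.restrict (interior C)) :=
          ⟨by simpa [volume_interior hconv] using hC.measure_lt_top⟩
        refine Integrable.of_bound (Real.measurable_log.comp_aemeasurable
          (aemeasurable_of_tendsto_directionFilter hC hconv hnn hlim)).aestronglyMeasurable
          (max |Real.log c| |Real.log B|)
          (ae_restrict_of_forall_mem isOpen_interior.measurableSet fun θ hθ => ?_)
        exact abs_le_max_abs_abs (Real.log_le_log hc (hIcc θ hθ).1)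
          (Real.log_le_log (hgpos θ hθ) (hIcc θ hθ).2)
      rw [erealIntegral_eq_coe (F := chebTransform C K w) hint
        (ae_restrict_of_forall_mem isOpen_interior.measurableSet fun θ hθ =>
          ENNReal.log_ofReal_of_pos (hgpos θ hθ)), ← EReal.coe_mul, EReal.exp_coe]
  · push Not at hpos
    have hzero : ∀ θ ∈ interior C, directionalCheb C K w θ = 0 := fun θ hθ =>
      le_antisymm (hpos θ hθ) (directionalCheb_mem_Icc hτ hconv hnn hθ
        fun k _ α _ => discreteCheb_nonneg hw k α).1
    refine ⟨0, le_rfl, ?_, ?_⟩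
    · -- compare with the truncations `max (T_k α) ρ`, whose geometric means tend to `ρ`
      rw [tendsto_order]
      refine ⟨fun a ha => Eventually.of_forall fun k =>
        ha.trans_le (Real.rpow_nonneg (hV0 k) _), fun a ha => ?_⟩
      have hρ : 0 < a / 2 := half_pos ha
      have hgm := tendsto_geometricMean hC hconv hnn hs hρ
        (t := fun k α => max (discreteCheb C K w k α) (a / 2)) (B := max B (a / 2))
        (g := fun _ => a / 2)
        (fun k hk α hα => ⟨le_max_right _ _, max_le_max_right _ (hτ.root_le hk hα)⟩)
        (fun θ hθ => by
          have h := (hlim θ hθ).max (tendsto_const_nhds (x := a / 2))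
          rwa [hzero θ hθ, max_eq_right hρ.le] at h)
        (fun _ _ => hρ.ne')
      have hexp : Real.exp ((vol C)⁻¹ * ∫ _ in interior C, Real.log (a / 2)) = a / 2 := by
        rw [setIntegral_const, measureReal_def, volume_interior hconv, ← vol, smul_eq_mul,
          inv_mul_cancel_left₀ hvol.ne', Real.exp_log hρ]
      rw [hexp] at hgm
      have hup := hfac.mul hgm
      rw [one_mul] at hup
      filter_upwards [hup.eventually (gt_mem_nhds (half_lt_self ha)), eventually_gt_atTop 0]
        with k hk hk0
      refine lt_of_le_of_lt ?_ hk
      have hprod : ∏ α ∈ (finite_latticePoints hC k).toFinset, minNorm C K w k α ≤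
          ∏ α ∈ (finite_latticePoints hC k).toFinset, max (discreteCheb C K w k α) (a / 2) ^ k := by
        refine Finset.prod_le_prod (fun α _ => minNorm_nonneg hw k α) fun α _ => ?_
        rw [← discreteCheb_pow hw hk0 α]
        exact pow_le_pow_left₀ (discreteCheb_nonneg hw k α) (le_max_left _ _) k
      rw [← Real.mul_rpow (Nat.cast_nonneg _) ((hP0 k).trans hprod)]
      refine Real.rpow_le_rpow (hV0 k) ?_ (by positivity)
      exact (prod_le_fullVandermonde_le hC hK hw hb k (e k)).2.trans
        (mul_le_mul_of_nonneg_left hprod (Nat.cast_nonneg _))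
    · have hμ : volume.restrict (interior C) ≠ 0 := by
        rw [Ne, Measure.restrict_eq_zero, volume_interior hconv]
        exact fun h0 => hvol.ne' (by rw [vol, h0, ENNReal.toReal_zero])
      rw [erealIntegral_eq_bot hμ (ae_restrict_of_forall_mem isOpen_interior.measurableSet
        fun θ hθ => by rw [chebTransform, hzero θ hθ, ENNReal.ofReal_zero, ENNReal.log_zero]),
        EReal.coe_mul_bot_of_pos (inv_pos.2 hvol), EReal.exp_bot, ENNReal.ofReal_zero]

lemma lintegral_chebTransform_lt_top (hC : IsCompact C) (hconv : Convex ℝ C)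
    (hnn : ∀ x ∈ C, ∀ i, 0 ≤ x i) (hw : ∀ z ∈ K, 0 ≤ w z)
    (hτ : IsSubmultiplicative C (minNorm C K w) B) :
    ∫⁻ θ in interior C, (chebTransform C K w θ).toENNReal < ⊤ := by
  refine setLIntegral_lt_top_of_le_nnreal ?_ ⟨(Real.log B).toNNReal, fun θ hθ => ?_⟩
  · rw [volume_interior hconv]
    exact hC.measure_lt_top.ne
  · have hle := (directionalCheb_mem_Icc hτ hconv hnn hθ
      fun k _ α _ => discreteCheb_nonneg hw k α).2
    have h := EReal.toENNReal_le_toENNReal (ENNReal.log_le_log (ENNReal.ofReal_le_ofReal hle))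
    rwa [ENNReal.log_ofReal_of_pos (zero_lt_one.trans_le hτ.one_le),
      EReal.real_coe_toENNReal] at h

lemma tendsto_orderDiameter (hN : 0 < N) (hC : IsCompact C) (hconv : Convex ℝ C)
    (hnn : ∀ x ∈ C, ∀ i, 0 ≤ x i) (hs : simplex N ⊆ C)
    (e : ∀ k, Fin (numPoints C k) ≃ latticePoints C k) {D : ℝ}
    (hD : Tendsto (fun k : ℕ => fullVandermonde C K w k (e k) ^
      (1 / ((k : ℝ) * (numPoints C k : ℝ)))) atTop (𝓝 D)) :
    Tendsto (fun k : ℕ => orderDiameter C K w k (e k)) atTop (𝓝 (D ^ (1 / normConst C))) := by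
  have hA := normConst_pos hN hC hnn hs
  have hexp := (tendsto_degreeSum_div_numPoints hC hconv hnn hs).inv₀ hA.ne'
  rw [← one_div] at hexp
  refine (hD.rpow hexp (Or.inr (one_div_pos.2 hA))).congr' ?_
  filter_upwards [eventually_gt_atTop 0, eventually_numPoints_pos hC hconv hnn hs] with k hk hM
  have hk' : (k : ℝ) ≠ 0 := Nat.cast_ne_zero.2 hk.ne'
  have hM' : (numPoints C k : ℝ) ≠ 0 := Nat.cast_ne_zero.2 hM.ne'
  have hV0 : 0 ≤ fullVandermonde C K w k (e k) := maxVandermonde_nonneg k _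
  rw [orderDiameter, ← Real.rpow_mul hV0, inv_div]
  congr 1
  field_simp

end Diameter

end ChebTransform

theorem theorem4p4 (N : ℕ) (hN : 0 < N)
    (C : Set (Fin N → ℝ)) (hCcompact : IsCompact C) (hCconvex : Convex ℝ C)
    (hCnonneg : ∀ x ∈ C, ∀ i, 0 ≤ x i) (hCsimplex : ChebTransform.simplex N ⊆ C)
    (K : Set (Fin N → ℂ)) (hK : IsCompact K)
    (w : (Fin N → ℂ) → ℝ) (hw_nonneg : ∀ z ∈ K, 0 ≤ w z) (hw_bdd : BddAbove (w '' K))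
    (e : ∀ k, Fin (ChebTransform.numPoints C k) ≃ ChebTransform.latticePoints C k) :
    -- the directional Chebyshev constants are well-defined limits
    (∀ θ ∈ interior C, (ChebTransform.directionFilter C θ).NeBot ∧
      Tendsto (fun x : ℕ × (Fin N →₀ ℕ) => ChebTransform.discreteCheb C K w x.1 x.2)
        (ChebTransform.directionFilter C θ) (𝓝 (ChebTransform.directionalCheb C K w θ))) ∧
    -- the integral of the Chebyshev transform is well defined in `[-∞, ∞)`
    AEMeasurable (ChebTransform.chebTransform C K w) (volume.restrict (interior C)) ∧
    (∫⁻ θ in interior C, (ChebTransform.chebTransform C K w θ).toENNReal) < ⊤ ∧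
    ∃ D : ℝ, 0 ≤ D ∧
      Tendsto (fun k : ℕ => ChebTransform.fullVandermonde C K w k (e k) ^
        (1 / ((k : ℝ) * (ChebTransform.numPoints C k : ℝ)))) atTop (𝓝 D) ∧
      ENNReal.ofReal D = EReal.exp ((((ChebTransform.vol C)⁻¹ : ℝ) : EReal) *
        ChebTransform.erealIntegral (ChebTransform.chebTransform C K w)
          (volume.restrict (interior C))) ∧
      Tendsto (fun k : ℕ => ChebTransform.orderDiameter C K w k (e k)) atTop
        (𝓝 (ChebTransform.transfiniteDiameter C K w e)) ∧
      ChebTransform.transfiniteDiameter C K w e = D ^ (1 / ChebTransform.normConst C) := by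
  obtain ⟨B, hB1, hB⟩ := ChebTransform.exists_minNorm_le_pow hCcompact hK hw_nonneg hw_bdd
  have hτ : ChebTransform.IsSubmultiplicative C (ChebTransform.minNorm C K w) B :=
    { nonneg := ChebTransform.minNorm_nonneg hw_nonneg
      one_le := hB1
      le_pow := hB
      add_le := fun _ _ _ hα _ hβ =>
        ChebTransform.minNorm_add_le hCconvex hK hw_nonneg hw_bdd hα hβ }
  have hlim := fun θ hθ =>
    ChebTransform.tendsto_directionalCheb (θ := θ) hτ hCconvex hCnonneg hθ
  obtain ⟨D, hD0, hD, hDint⟩ := ChebTransform.exists_tendsto_fullVandermonde hCcompact hCconvex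
    hCnonneg hCsimplex hK hw_nonneg hw_bdd hτ e
  have hdiam := ChebTransform.tendsto_orderDiameter hN hCcompact hCconvex hCnonneg hCsimplex e hD
  have heq : ChebTransform.transfiniteDiameter C K w e = D ^ (1 / ChebTransform.normConst C) :=
    hdiam.limsup_eq
  refine ⟨fun θ hθ => ⟨ChebTransform.directionFilter_neBot hCnonneg hθ, hlim θ hθ⟩, ?_,
    ChebTransform.lintegral_chebTransform_lt_top hCcompact hCconvex hCnonneg hw_nonneg hτ,
    D, hD0, hD, hDint, heq ▸ hdiam, heq⟩
  exact ENNReal.measurable_log.comp_aemeasurable (ENNReal.measurable_ofReal.comp_aemeasurable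
    (ChebTransform.aemeasurable_of_tendsto_directionFilter hCcompact hCconvex hCnonneg hlim))
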